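/- Setting. Consider a system of ordinary differential equations $y_j^{(m_j)}=\omega_j\bigl(x,y_i^{(l)}:l<m_i\bigr)$, $j=1,\dots,k$, $m_j\ge 1$, with smooth right-hand sides on an open set $U$ of jets, represented by the operator $\mathbf A=\partial_x+\sum_j\bigl(\sum_{l+1<m_j}y_j^{(l+1)}\partial_{y_j^{(l)}}+\omega_j\,\partial_{y_j^{(m_j-1)}}\bigr)$. Let $\mathfrak g$ be a finite-dimensional real Lie algebra of Lie point symmetries of it, i.e. of vector fields on $U$ that are prolongations $\mathbf Z$ of smooth fields $\xi(x,y)\partial_x+\sum_j\eta_j(x,y)\partial_{y_j}$ and satisfy $[\mathbf Z,\mathbf A]=-\mathbf A(\xi)\mathbf A$. One application of the *first integration method* to an operator $\mathbf A$ and a Lie algebra of generators consists of the following. One chooses linearly independent commuting generators $\mathbf Z_1,\dots,\mathbf Z_m$ ($m\ge1$) and a subalgebra of generators $\mathfrak h\ni\mathbf Z_i$ to be kept, all of which satisfy the inheritance conditions $[\mathbf Z_i,\mathbf X]\in\operatorname{span}(\mathbf Z_1,\dots,\mathbf Z_m)$ for $\mathbf X\in\mathfrak h$. On some nonempty open set one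 introduces smooth coordinates $(s^1,\dots,s^m,t,v)$ with $\mathbf Z_i=\partial_{s^i}$, $\mathbf A(t)\neq0$, where $t,s^i$ are functions of the variables only (of $(x,y)$ in the first application; of all the coordinates of the reduced system later), such that $\mathbf A=\mathbf A(t)\bigl(\hat{\mathbf A}+\sum_i u^i(t,v)\partial_{s^i}\bigr)$ with $\hat{\mathbf A}$ an operator in $(t,v)$ with $\hat{\mathbf A}(t)=1$. The reduced system is given by $\hat{\mathbf A}$, together with the quadratures $s^i=\int u^i\,dt+c^i$. Its generators are the reduced forms $\mathbf Y$ of the $\mathbf X\in\mathfrak h$, that is, $\mathbf X=\mathbf Y+\sum_i\eta^i\partial_{s^i}$ with $\mathbf Y$ a vector field in $(t,v)$; it is required that the $\mathbf Y$ exist and that independent generators in $\mathfrak h$ modulo $\operatorname{span}(\mathbf Z_i)$ have linearly independent reduced forms. The method is then repeated on the reduced system. A list of generators of $\mathfrak g$ is *used* by such a procedure if it consists of the generators transformed into normal form in the successive applications, those of the later applications being transformed through their reduced forms. Let $\mathfrak s$ be a maximal solvable subalgebra of $\mathfrak g$, i.e. a solvable subalgebra of the largest possible dimension. **Theorem 6.**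 The use of $\mathfrak s$ is the most profitable way of using the symmetry generators by the first integration method: 1. Every procedure uses at most $\dim\mathfrak s$ generators. 2. All the generators of $\mathfrak s$ can be used, provided that $\mathfrak s$ acts transitively: at some jet $p\in U$ a basis of $\mathfrak s$ together with $\mathbf A$ is linearly independent at $p$, and in the space of the variables $(x,y)$ a basis of the last nonzero derived algebra of $\mathfrak s$ together with $\mathbf A$ is linearly independent at $p$. That is, there is then a procedure that uses a basis of $\mathfrak s$. 3. The generators used by a procedure always form a basis of a solvable subalgebra of $\mathfrak g$. 4. No generators outside $\mathfrak s$ can be added: (a) if the span of the generators used by a procedure contains $\mathfrak s$, all of them lie in $\mathfrak s$; (b) if $\mathbf X\in\mathfrak g$ satisfies $[\mathfrak s^{(n)},\mathbf X]\subseteq\mathfrak s^{(n)}$ for all the derived algebras $\mathfrak s^{(n)}$, $n\ge0$, of $\mathfrak s$, then $\mathbf X\in\mathfrak s$; (c) if $\mathfrak a\subseteq\mathfrak g$ is a linear subspace with $[\mathfrak a,\mathfrak a]=0$ and $[\mathfrak a,\mathfrak s]\subseteq\mathfrak a$, then $\mathfrak a\subseteq\mathfrak s$. -/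

import Mathlib

open Set TopologicalSpace VectorField
open scoped ContDiff

namespace FirstIntegration

noncomputable section

/-! ### The Lie algebra of smooth vector fields on an open set -/

/-- The smooth vector fields on an open subset `U` of a normed space `E`. A field is stored as a
function on `E` that vanishes off `U`, so that two fields are equal iff they agree on `U`. -/
def VF {E : Type*} [NormedAddCommGroup E] [NormedSpace ℝ E] (U : Opens E) :
    Submodule ℝ (E → E) where
  carrier := {X | ContDiffOn ℝ ∞ X U ∧ ∀ p ∉ U, X p = 0}
  add_mem' := by
    rintro X Y ⟨hX, hX0⟩ ⟨hY, hY0⟩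
    exact ⟨hX.add hY, fun p hp => by simp [hX0 p hp, hY0 p hp]⟩
  zero_mem' := ⟨contDiffOn_const, fun _ _ => rfl⟩
  smul_mem' := by
    rintro c X ⟨hX, hX0⟩
    exact ⟨hX.const_smul c, fun p hp => by simp [hX0 p hp]⟩

section LieStructure

variable {E : Type*} [NormedAddCommGroup E] [NormedSpace ℝ E] {U : Opens E}

theorem contDiffAt_of_mem (X : VF U) {p : E} (hp : p ∈ U) : ContDiffAt ℝ ∞ X.1 p :=
  (X.2.1 p hp).contDiffAt (U.isOpen.mem_nhds hp)

theorem differentiableAt_of_mem (X : VF U) {p : E} (hp : p ∈ U) : DifferentiableAt ℝ X.1 p :=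
  (contDiffAt_of_mem X hp).differentiableAt (by simp)

/-- The commutator `[X, Y]` of vector fields, `[X, Y] f = X (Y f) - Y (X f)`. -/
instance : Bracket (VF U) (VF U) where
  bracket X Y := ⟨lieBracket ℝ X.1 Y.1,
    fun _ hp => ((contDiffAt_of_mem X hp).lieBracket_vectorField (contDiffAt_of_mem Y hp)
      (by exact le_rfl)).contDiffWithinAt,
    fun p hp => lieBracket_eq_zero_of_eq_zero (X.2.2 p hp) (Y.2.2 p hp)⟩

theorem VF.lie_val (X Y : VF U) : (⁅X, Y⁆ : VF U).1 = lieBracket ℝ X.1 Y.1 := rfl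

theorem VF.ext_on {X Y : VF U} (h : ∀ p ∈ U, X.1 p = Y.1 p) : X = Y := by
  apply Subtype.ext
  funext p
  by_cases hp : p ∈ U
  · exact h p hp
  · rw [X.2.2 p hp, Y.2.2 p hp]

instance : LieRing (VF U) where
  add_lie X Y Z := VF.ext_on fun p hp =>
    lieBracket_add_left (differentiableAt_of_mem X hp) (differentiableAt_of_mem Y hp)
  lie_add X Y Z := VF.ext_on fun p hp =>
    lieBracket_add_right (differentiableAt_of_mem Y hp) (differentiableAt_of_mem Z hp)
  lie_self X := Subtype.ext lieBracket_self
  leibniz_lie X Y Z := VF.ext_on fun p hp =>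
    leibniz_identity_lieBracket (n := ∞) (by
      rw [minSmoothness_of_isRCLikeNormedField]
      exact WithTop.coe_le_coe.2 (le_top : (2 : ℕ∞) ≤ ⊤))
      (contDiffAt_of_mem X hp) (contDiffAt_of_mem Y hp) (contDiffAt_of_mem Z hp)

instance : LieAlgebra ℝ (VF U) where
  lie_smul _ _ Y := VF.ext_on fun _ hp =>
    lieBracket_const_smul_right (differentiableAt_of_mem Y hp)

end LieStructure

/-! ### Systems of ordinary differential equations and their Lie point symmetries -/

/-- A system of `k` ordinary differential equations, solved for the highest derivatives:
`y_j^{(m_j)} = ω_j (x, y_i^{(l)} : l < m_i)`, with orders `m_j ≥ 1`. The jet coordinate `none` is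
the independent variable `x`, the jet coordinate `some ⟨j, l⟩` is `y_j^{(l)}`. -/
structure ODESystem (k : ℕ) where
  /-- The orders of the equations. -/
  order : Fin k → ℕ
  order_pos : ∀ j, 0 < order j
  /-- The open set of jets on which the system is considered. -/
  domain : Opens (Option (Σ j, Fin (order j)) → ℝ)
  /-- The right-hand sides. -/
  rhs : Fin k → (Option (Σ j, Fin (order j)) → ℝ) → ℝ
  rhs_smooth : ∀ j, ContDiffOn ℝ ∞ (rhs j) domain

namespace ODESystem

variable {k : ℕ} (S : ODESystem k)

/-- The jets `(x, y_j^{(l)} : l < m_j)`. -/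
abbrev Jet : Type := Option (Σ j, Fin (S.order j)) → ℝ

/-- The projection of a jet to the variables `(x, y_j)`. -/
def base (p : S.Jet) : Option (Fin k) → ℝ
  | none => p none
  | some j => p (some ⟨j, ⟨0, S.order_pos j⟩⟩)

/-- The value of `y_j^{(l)}` for `l ≤ m_j`; for `l = m_j` it is given by the equations. -/
def jetCoord (j : Fin k) (l : ℕ) (p : S.Jet) : ℝ :=
  if h : l < S.order j then p (some ⟨j, ⟨l, h⟩⟩) else S.rhs j p

/-- The components of
`A = ∂_x + ∑_j (∑_{l + 1 < m_j} y_j^{(l+1)} ∂_{y_j^{(l)}} + ω_j ∂_{y_j^{(m_j - 1)}})`. -/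
def opFun (p : S.Jet) : S.Jet
  | none => 1
  | some ⟨j, l⟩ => S.jetCoord j (l + 1) p

theorem opFun_smooth : ContDiffOn ℝ ∞ S.opFun S.domain := by
  rw [contDiffOn_pi]
  rintro (_ | ⟨j, l⟩)
  · exact contDiffOn_const
  · simp only [opFun, jetCoord]
    by_cases h : (l : ℕ) + 1 < S.order j
    · simp only [h, dif_pos]
      exact (contDiff_apply ℝ ℝ _).contDiffOn
    · simp only [h, dif_neg, not_false_eq_true]
      exact S.rhs_smooth j

open Classical in
/-- The first order operator `A` that represents the system, a vector field on the jets: a function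
`f` on the jets is a first integral iff `A f = 0`. -/
def op : VF S.domain :=
  ⟨fun p => if p ∈ S.domain then S.opFun p else 0,
    S.opFun_smooth.congr fun _ hp => if_pos hp, fun _ hp => if_neg hp⟩

/-- The derivative `A f` of a function along the solutions. -/
def D (f : S.Jet → ℝ) (p : S.Jet) : ℝ := fderiv ℝ f p (S.op.1 p)

/-- The coefficients `η_j^{(l)}` of the prolongation of the generator
`ζ = ξ(x, y) ∂_x + ∑_j η_j(x, y) ∂_{y_j}`: `η_j^{(0)} = η_j` and
`η_j^{(l+1)} = dη_j^{(l)}/dx - y_j^{(l+1)} dξ/dx`. -/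
def prolongCoeff (ζ : (Option (Fin k) → ℝ) → (Option (Fin k) → ℝ)) (j : Fin k) :
    ℕ → S.Jet → ℝ
  | 0 => fun p => ζ (S.base p) (some j)
  | l + 1 => fun p => S.D (prolongCoeff ζ j l) p
      - S.jetCoord j (l + 1) p * S.D (fun q => ζ (S.base q) none) p

/-- The prolongation of a generator `ζ` on the variables to the jets. -/
def prolong (ζ : (Option (Fin k) → ℝ) → (Option (Fin k) → ℝ)) (p : S.Jet) : S.Jet
  | none => ζ (S.base p) none
  | some ⟨j, l⟩ => S.prolongCoeff ζ j l p

/-- `X` is (the prolongation of) a Lie point symmetry generator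
`Z = ξ(x, y) ∂_x + ∑_j η_j(x, y) ∂_{y_j}` of the system: `[X, A] = -A(ξ) A`. -/
def IsPointSymmetry (X : VF S.domain) : Prop :=
  ∃ ζ : (Option (Fin k) → ℝ) → (Option (Fin k) → ℝ),
    ContDiffOn ℝ ∞ ζ (S.base '' S.domain) ∧
    (∀ p ∈ S.domain, X.1 p = S.prolong ζ p) ∧
    ∀ p ∈ S.domain, (⁅X, S.op⁆ : VF S.domain).1 p
      = -(S.D (fun q => ζ (S.base q) none) p) • S.op.1 p

end ODESystem

/-! ### The first integration method -/

/-- A stage of the first integration method: a system of differential equations, represented by a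
first order operator `A = ∂_t + ∑_i A^i ∂_{v^i}` on an open set of a space with coordinates
`(t, v^i)`, and the Lie algebra of generators that is at our disposal. The coordinate `none` is the
independent variable `t`. The set `vars` tells which of the `v^i` count as dependent variables of
the system, the other ones being derivatives. -/
structure Stage where
  ι : Type
  [fintype : Fintype ι]
  vars : Set ι
  U : Opens (Option ι → ℝ)
  A : VF U
  A_time : ∀ p ∈ U, A.1 p none = 1
  gens : LieSubalgebra ℝ (VF U)

attribute [instance] Stage.fintype

/-- The initial stage for a system of ordinary differential equations and a Lie algebra of
(prolonged) generators. -/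
def ODESystem.stage {k : ℕ} (S : ODESystem k) (g : LieSubalgebra ℝ (VF S.domain)) : Stage where
  ι := Σ j, Fin (S.order j)
  vars := {i | (i.2 : ℕ) = 0}
  U := S.domain
  A := S.op
  A_time p hp := by
    simp [op, opFun, hp]
  gens := g

/-- One application of the first integration method, with `m` generators `Z_1, …, Z_m` that are
transformed simultaneously into their normal form `Z_i = ∂_{s^i}`. It leads from the system `S` to
the reduced system `S'`. -/
structure Step (S S' : Stage) (m : ℕ) where
  pos : 0 < m
  /-- The generators `Z_i` that are transformed into normal form. -/
  Z : Fin m → VF S.U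
  /-- The span of the `Z_i` and of the generators `Z_l̄` that are kept. -/
  kept : LieSubalgebra ℝ (VF S.U)
  kept_le : kept ≤ S.gens
  Z_mem : ∀ i, Z i ∈ kept
  Z_indep : LinearIndependent ℝ Z
  /-- `[Z_i, Z_j] = 0`. -/
  abelian : ∀ i j, ⁅Z i, Z j⁆ = 0
  /-- The inheritance conditions `[Z_i, Z_l̄] = ∑_l C^l_{i l̄} Z_l`. -/
  inherit : ∀ i, ∀ X ∈ kept, ⁅Z i, X⁆ ∈ Submodule.span ℝ (range Z)
  /-- The new coordinates, `p ↦ (s, (t, v))`. -/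
  chart : OpenPartialHomeomorph (Option S.ι → ℝ) ((Fin m → ℝ) × (Option S'.ι → ℝ))
  source_nonempty : chart.source.Nonempty
  source_subset : chart.source ⊆ S.U
  smooth : ContDiffOn ℝ ∞ chart chart.source
  smooth_symm : ContDiffOn ℝ ∞ chart.symm chart.target
  /-- The new variables `t` and `s^i` are functions of the old variables only. -/
  point : ∀ p ∈ chart.source, ∀ q ∈ chart.source, p none = q none →
    (∀ i ∈ S.vars, p (some i) = q (some i)) →
    (chart p).1 = (chart q).1 ∧ (chart p).2 none = (chart q).2 none
  /-- `Z_i = ∂_{s^i}`. -/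
  normal_form : ∀ p ∈ chart.source, ∀ i, fderiv ℝ chart p ((Z i).1 p) = (Pi.single i 1, 0)
  /-- The reduced system lives on the space of the `(t, v)`. -/
  reduced_domain : (S'.U : Set (Option S'.ι → ℝ)) = Prod.snd '' chart.target
  /-- All the coordinates `v` are the variables of the reduced system, whose generators may depend
  on each of them. -/
  reduced_vars : S'.vars = univ
  /-- `t` can serve as the independent variable: `A(t) ≠ 0`. -/
  time : ∀ p ∈ chart.source, (fderiv ℝ chart p (S.A.1 p)).2 none ≠ 0
  /-- The functions `ds^i/dt = u^i(t, v)`, which provide the quadratures `s^i = ∫ u^i dt + c^i`. -/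
  u : (Option S'.ι → ℝ) → (Fin m → ℝ)
  /-- `A = A(t) (Â + ∑_i u^i(t, v) ∂_{s^i})`, where `Â` is the operator of the reduced system. -/
  operator : ∀ p ∈ chart.source, fderiv ℝ chart p (S.A.1 p)
    = (fderiv ℝ chart p (S.A.1 p)).2 none • (u (chart p).2, S'.A.1 (chart p).2)
  /-- Each kept generator `X` has a reduced form `Y` among the generators of the reduced system. -/
  reduce : ∀ X ∈ kept, ∃ Y ∈ S'.gens, ∀ p ∈ chart.source,
    (fderiv ℝ chart p (X.1 p)).2 = Y.1 (chart p).2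
  /-- The generators of the reduced system are the reduced forms of the kept generators. -/
  reduced_gens : ∀ Y ∈ S'.gens, ∃ X ∈ kept, ∀ p ∈ chart.source,
    (fderiv ℝ chart p (X.1 p)).2 = Y.1 (chart p).2
  /-- The reduced forms `Y_l̄` of the kept generators `Z_l̄` are linearly independent. -/
  reduced_indep : ∀ X ∈ kept, (∀ p ∈ chart.source, (fderiv ℝ chart p (X.1 p)).2 = 0) →
    X ∈ Submodule.span ℝ (range Z)

/-- `X = Y + ∑_i η^i ∂_{s^i}` in the new coordinates, i.e. `Y` is the reduced form of `X`. -/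
def Step.Reduces {S S' : Stage} {m : ℕ} (σ : Step S S' m) (X : VF S.U) (Y : VF S'.U) : Prop :=
  ∀ p ∈ σ.chart.source, (fderiv ℝ σ.chart p (X.1 p)).2 = Y.1 (σ.chart p).2

/-- `Uses S L`: starting from the stage `S`, the generators in the list `L` can all be used, in this
order, by repeated application of the first integration method. A generator that is used in a later
step is used through its reduced form. -/
inductive Uses : (S : Stage) → List (VF S.U) → Prop
  | nil (S : Stage) : Uses S []
  | step {S S' : Stage} {m : ℕ} (σ : Step S S' m) (L : List (VF S.U)) (L' : List (VF S'.U))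
      (hL' : Uses S' L') (hL : ∀ X ∈ L, X ∈ σ.kept) (hred : List.Forall₂ σ.Reduces L L') :
      Uses S (List.ofFn σ.Z ++ L)

/-- The linear span of a list of generators. -/
def spanOf {E : Type*} [NormedAddCommGroup E] [NormedSpace ℝ E] {U : Opens E} (L : List (VF U)) :
    Submodule ℝ (VF U) :=
  Submodule.span ℝ {X | X ∈ L}

/-- `s` is a maximal solvable subalgebra of `g`: one of the largest possible dimension. -/
structure IsMaximalSolvable {L : Type*} [LieRing L] [LieAlgebra ℝ L]
    (g s : LieSubalgebra ℝ L) : Prop where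
  le : s ≤ g
  solvable : LieAlgebra.IsSolvable s
  finrank_le : ∀ t : LieSubalgebra ℝ L, t ≤ g → LieAlgebra.IsSolvable t →
    Module.finrank ℝ t ≤ Module.finrank ℝ s

/-- The transitivity assumption at the jet `p`: a basis of `s` and `A` are linearly independent
at `p`, and so are, in the space of the variables `(x, y)`, a basis of the last nonzero derived
algebra of `s` and `A`. -/
structure ODESystem.ActsTransitively {k : ℕ} (S : ODESystem k)
    (s : LieSubalgebra ℝ (VF S.domain)) (p : S.Jet) : Prop where
  on_jets : ∀ X ∈ s, ∀ c : ℝ, X.1 p = c • S.op.1 p → X = 0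
  on_variables : ∀ X ∈ LieAlgebra.derivedAbelianOfIdeal (⊤ : LieIdeal ℝ s), ∀ c : ℝ,
    S.base (X.1.1 p) = c • S.base (S.op.1 p) → X = 0

end

end FirstIntegration

/-! The upper bounds are pure Lie theory. In one application, passing to reduced forms is a Lie
algebra homomorphism on the kept generators, and its kernel is exactly the Abelian span of the
`Z_i`. By induction over the applications, the used generators span an iterated extension of Abelian
algebras. This is a solvable subalgebra whose dimension is the length of the list
(`Uses.exists_solvable`), so it is at most `dim s`, and it equals `s` as soon as it contains `s`.
The other two maximality statements hold because `s + ℝX`, respectively `a + s`, would be a solvable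
subalgebra of `g` containing `s` (`isSolvable_of_lie_mem`, `isSolvable_of_le_sup`).

Existence is the analytic half. The last nonzero derived algebra of `s` is an Abelian ideal, so a
basis of it commutes and all of `s` satisfies the inheritance conditions. Transitivity on the
variables makes this basis and `A` independent after projection to the variables, so the basis can
be straightened to `∂_{s^i}` by coordinates in which `s` and `t` depend on the variables only
(`exists_straightening`). In these coordinates `A/A(t)` and the reduced forms do not depend on `s`.
The reduced algebra is the quotient of `s` by the ideal, and it is again solvable and transitive at
the image point, so induction on the dimension applies (`exists_step`, `exists_uses`).

Straightening needs a smooth joint flow of commuting fields. It comes from the inverse function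
theorem in the Banach space of paths, applied to the integral equation of the flow
(`exists_flow_of_global`). Uniqueness for the projected differential equation shows that the flow
descends to the variables. -/

namespace FirstIntegration

/-! ### Solvability of extensions -/

section Solvable

variable {R L M : Type*} [CommRing R] [LieRing L] [LieAlgebra R L] [LieRing M] [LieAlgebra R M]

/-- If the `k`-th derived algebra of `M` vanishes, that of `L` lies in the kernel, and `l` further
derivations annihilate it. -/
theorem isSolvable_of_isSolvable_ker (f : L →ₗ⁅R⁆ M) [LieAlgebra.IsSolvable f.ker]
    [LieAlgebra.IsSolvable M] : LieAlgebra.IsSolvable L := by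
  obtain ⟨k, hk⟩ := LieAlgebra.IsSolvable.solvable R M
  obtain ⟨l, hl⟩ := LieAlgebra.IsSolvable.solvable R f.ker
  have h1 : LieAlgebra.derivedSeries R L k ≤ f.ker := by
    have := LieIdeal.derivedSeries_map_le (f := f) k
    rw [hk, LieIdeal.map_le_iff_le_comap] at this
    intro x hx
    have h2 := this hx
    rw [LieIdeal.mem_comap, LieSubmodule.mem_bot] at h2
    rwa [LieHom.mem_ker]
  rw [LieIdeal.derivedSeries_eq_bot_iff] at hl
  refine LieAlgebra.IsSolvable.mk (R := R) (k := l + k) ?_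
  rw [LieAlgebra.derivedSeries_def, LieAlgebra.derivedSeriesOfIdeal_add, eq_bot_iff, ← hl]
  exact LieAlgebra.derivedSeriesOfIdeal_mono h1 l

/-- Bounds the derived series by explicit subspaces of the ambient algebra, which need be neither
ideals nor subspaces of `t`. -/
theorem derivedSeries_le_filtration {t : LieSubalgebra R L} (P : ℕ → Submodule R L)
    (h0 : t.toSubmodule ≤ P 0) (hP : ∀ n, ∀ x ∈ P n, ∀ y ∈ P n, ⁅x, y⁆ ∈ P (n + 1)) (n : ℕ) :
    ∀ x ∈ LieAlgebra.derivedSeries R t n, (x : L) ∈ P n := by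
  induction n with
  | zero => exact fun x _ => h0 x.2
  | succ n ih =>
    intro x hx
    rw [LieAlgebra.derivedSeries_def, LieAlgebra.derivedSeriesOfIdeal_succ,
      ← LieSubmodule.mem_toSubmodule, LieSubmodule.lieIdeal_oper_eq_linear_span'] at hx
    induction hx using Submodule.span_induction with
    | mem x h =>
      obtain ⟨y, hy, z, hz, rfl⟩ := h
      exact hP n _ (ih y hy) _ (ih z hz)
    | zero => exact zero_mem _
    | add x y _ _ hx hy => exact add_mem hx hy
    | smul c x _ hx => exact Submodule.smul_mem _ c hx

/-- The terms of the derived series of a subalgebra, as subspaces of the whole algebra. -/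
def derivedSpace (s : LieSubalgebra R L) (n : ℕ) : Submodule R L :=
  (LieAlgebra.derivedSeries R s n).toSubmodule.map s.toSubmodule.subtype

theorem mem_derivedSpace {s : LieSubalgebra R L} {n : ℕ} {x : L} :
    x ∈ derivedSpace s n ↔ ∃ y ∈ LieAlgebra.derivedSeries R s n, (y : L) = x := Iff.rfl

theorem derivedSpace_le (s : LieSubalgebra R L) (n : ℕ) : derivedSpace s n ≤ s.toSubmodule := by
  rintro _ ⟨y, -, rfl⟩
  exact y.2

theorem derivedSpace_zero (s : LieSubalgebra R L) : derivedSpace s 0 = s.toSubmodule := by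
  refine le_antisymm (derivedSpace_le s 0) fun x hx => ?_
  exact mem_derivedSpace.2 ⟨⟨x, hx⟩, LieSubmodule.mem_top _, rfl⟩

theorem lie_mem_derivedSpace {s : LieSubalgebra R L} {n : ℕ} {x y : L}
    (hx : x ∈ derivedSpace s n) (hy : y ∈ derivedSpace s n) :
    ⁅x, y⁆ ∈ derivedSpace s (n + 1) := by
  obtain ⟨x', hx', rfl⟩ := mem_derivedSpace.1 hx
  obtain ⟨y', hy', rfl⟩ := mem_derivedSpace.1 hy
  refine mem_derivedSpace.2 ⟨⁅x', y'⁆, ?_, rfl⟩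
  rw [LieAlgebra.derivedSeries_def, LieAlgebra.derivedSeriesOfIdeal_succ]
  exact LieSubmodule.lie_mem_lie hx' hy'

theorem exists_derivedSpace_eq_bot (s : LieSubalgebra R L) [LieAlgebra.IsSolvable s] :
    ∃ k, derivedSpace s k = ⊥ := by
  obtain ⟨k, hk⟩ := LieAlgebra.IsSolvable.solvable R s
  exact ⟨k, by simp [derivedSpace, hk]⟩

/-- A Lie subalgebra whose commutators lie in a solvable subalgebra is solvable. -/
theorem isSolvable_of_lie_mem {s t : LieSubalgebra R L} [LieAlgebra.IsSolvable s]
    (h : ∀ x ∈ t, ∀ y ∈ t, ⁅x, y⁆ ∈ s) : LieAlgebra.IsSolvable t := by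
  obtain ⟨k, hk⟩ := exists_derivedSpace_eq_bot s
  refine LieAlgebra.IsSolvable.mk (R := R) (k := k + 1) (eq_bot_iff.2 fun x hx => ?_)
  -- The filtration is `t` followed by the derived series of `s`, shifted by one.
  have := derivedSeries_le_filtration
    (fun n => Nat.casesOn n t.toSubmodule fun n => derivedSpace s n) le_rfl
    (fun n => Nat.casesOn n (fun x hx y hy => by
      show _ ∈ derivedSpace s 0
      rw [derivedSpace_zero]
      exact h x hx y hy) fun n x hx y hy => lie_mem_derivedSpace hx hy) (k + 1) x hx
  simpa [hk] using this

/-- The sum of an Abelian subspace and of a solvable subalgebra that normalizes it. -/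
theorem isSolvable_of_le_sup {s t : LieSubalgebra R L} [LieAlgebra.IsSolvable s]
    {a : Submodule R L} (h : t.toSubmodule ≤ a ⊔ s.toSubmodule)
    (ha : ∀ x ∈ a, ∀ y ∈ a, ⁅x, y⁆ = 0) (has : ∀ x ∈ a, ∀ y ∈ s, ⁅x, y⁆ ∈ a) :
    LieAlgebra.IsSolvable t := by
  obtain ⟨k, hk⟩ := exists_derivedSpace_eq_bot s
  -- All brackets involving `a` fall into `a`, so modulo `a` only the derived series of `s` remains.
  have key := derivedSeries_le_filtration (fun n => a ⊔ derivedSpace s n)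
    (by rw [derivedSpace_zero]; exact h) (fun n x hx y hy => by
      obtain ⟨x', hx', u, hu, rfl⟩ := Submodule.mem_sup.1 hx
      obtain ⟨y', hy', v, hv, rfl⟩ := Submodule.mem_sup.1 hy
      rw [add_lie, lie_add, lie_add, ha x' hx' y' hy', zero_add, ← add_assoc]
      refine Submodule.add_mem_sup (add_mem (has x' hx' v (derivedSpace_le s n hv)) ?_)
        (lie_mem_derivedSpace hu hv)
      rw [← lie_skew]
      exact neg_mem (has y' hy' u (derivedSpace_le s n hu))) k
  -- At stage `k` the derived series of `t` has sunk into `a`; since `a` is Abelian, one more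
  -- bracket kills it.
  refine LieAlgebra.IsSolvable.mk (R := R) (k := k + 1) ?_
  rw [LieAlgebra.derivedSeries_def, LieAlgebra.derivedSeriesOfIdeal_succ,
    LieSubmodule.lie_eq_bot_iff]
  intro x hx y hy
  simp only [hk, sup_bot_eq] at key
  exact Subtype.ext (ha _ (key x hx) _ (key y hy))

theorem lie_eq_zero_of_mem_span {ι : Type*} {Z : ι → L} (hZ : ∀ i j, ⁅Z i, Z j⁆ = 0) {x y : L}
    (hx : x ∈ Submodule.span R (range Z)) (hy : y ∈ Submodule.span R (range Z)) : ⁅x, y⁆ = 0 := by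
  induction hx, hy using Submodule.span_induction₂ with
  | mem_mem x y hx hy =>
    obtain ⟨i, rfl⟩ := hx
    obtain ⟨j, rfl⟩ := hy
    exact hZ i j
  | zero_left y _ => exact zero_lie y
  | zero_right x _ => exact lie_zero x
  | add_left x y z _ _ _ h₁ h₂ => rw [add_lie, h₁, h₂, add_zero]
  | add_right x y z _ _ _ h₁ h₂ => rw [lie_add, h₁, h₂, add_zero]
  | smul_left c x y _ _ h => rw [smul_lie, h, smul_zero]
  | smul_right c x y _ _ h => rw [lie_smul, h, smul_zero]

end Solvable

/-! ### Maximal solvable subalgebras -/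

section Maximal

variable {L : Type*} [LieRing L] [LieAlgebra ℝ L] {g s : LieSubalgebra ℝ L}

theorem IsMaximalSolvable.eq_of_le [FiniteDimensional ℝ g] (hs : IsMaximalSolvable g s)
    {t : LieSubalgebra ℝ L} (ht : t ≤ g) (htsolv : LieAlgebra.IsSolvable t) (hst : s ≤ t) :
    t = s := by
  have : FiniteDimensional ℝ t.toSubmodule :=
    Submodule.finiteDimensional_of_le (S₂ := g.toSubmodule) ht
  have h := Submodule.eq_of_le_of_finrank_le (S₁ := s.toSubmodule) (S₂ := t.toSubmodule) hst
    (hs.finrank_le t ht htsolv)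
  exact (LieSubalgebra.toSubmodule_injective h).symm

/-- All commutators of `s + ℝx` lie in `s`, because `[x, x] = 0`. So it is a solvable subalgebra
containing `s`, and maximality leaves no room for `x`. -/
theorem IsMaximalSolvable.mem_of_lie_mem [FiniteDimensional ℝ g] (hs : IsMaximalSolvable g s)
    {x : L} (hx : x ∈ g) (h : ∀ y ∈ s, ⁅y, x⁆ ∈ s) : x ∈ s := by
  have := hs.solvable
  have key : ∀ y ∈ s.toSubmodule ⊔ Submodule.span ℝ {x},
      ∀ z ∈ s.toSubmodule ⊔ Submodule.span ℝ {x}, ⁅y, z⁆ ∈ s := by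
    intro y hy z hz
    obtain ⟨y', hy', u, hu, rfl⟩ := Submodule.mem_sup.1 hy
    obtain ⟨z', hz', v, hv, rfl⟩ := Submodule.mem_sup.1 hz
    obtain ⟨a, rfl⟩ := Submodule.mem_span_singleton.1 hu
    obtain ⟨b, rfl⟩ := Submodule.mem_span_singleton.1 hv
    rw [add_lie, lie_add, lie_add, lie_smul b, smul_lie a, smul_lie a, lie_smul b x x, lie_self,
      smul_zero, smul_zero, add_zero]
    refine add_mem (add_mem (s.lie_mem hy' hz') (s.smul_mem _ (h y' hy'))) (s.smul_mem _ ?_)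
    rw [← lie_skew]
    exact neg_mem (h z' hz')
  let t : LieSubalgebra ℝ L :=
    { s.toSubmodule ⊔ Submodule.span ℝ {x} with
      lie_mem' := fun {y z} hy hz => Submodule.mem_sup_left (key y hy z hz) }
  have hst : s ≤ t := fun y hy => Submodule.mem_sup_left (S := s.toSubmodule) hy
  have htg : t ≤ g := by
    have : s.toSubmodule ⊔ Submodule.span ℝ {x} ≤ g.toSubmodule :=
      sup_le hs.le ((Submodule.span_singleton_le_iff_mem _ _).2 hx)
    exact this
  rw [← hs.eq_of_le htg (isSolvable_of_lie_mem (s := s) key) hst]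
  exact Submodule.mem_sup_right (Submodule.mem_span_singleton_self x)

/-- Here `a + s` is a subalgebra in which `a` is an Abelian ideal with solvable quotient, so it is
solvable and coincides with `s`. -/
theorem IsMaximalSolvable.le_of_abelian [FiniteDimensional ℝ g] (hs : IsMaximalSolvable g s)
    {a : Submodule ℝ L} (hag : a ≤ g.toSubmodule) (ha : ∀ x ∈ a, ∀ y ∈ a, ⁅x, y⁆ = 0)
    (has : ∀ x ∈ a, ∀ y ∈ s, ⁅x, y⁆ ∈ a) : a ≤ s.toSubmodule := by
  have := hs.solvable
  let t : LieSubalgebra ℝ L :=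
    { a ⊔ s.toSubmodule with
      lie_mem' := fun {x y} hx hy => by
        obtain ⟨x', hx', u, hu, rfl⟩ := Submodule.mem_sup.1 hx
        obtain ⟨y', hy', v, hv, rfl⟩ := Submodule.mem_sup.1 hy
        rw [add_lie, lie_add, lie_add, ha x' hx' y' hy', zero_add, ← add_assoc]
        refine Submodule.add_mem_sup (add_mem (has x' hx' v hv) ?_) (s.lie_mem hu hv)
        rw [← lie_skew]
        exact neg_mem (has y' hy' u hu) }
  have htg : t ≤ g := by
    have : a ⊔ s.toSubmodule ≤ g.toSubmodule := sup_le hag hs.le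
    exact this
  have hst : s ≤ t := fun y hy => Submodule.mem_sup_right (S := a) hy
  have := hs.eq_of_le htg (isSolvable_of_le_sup (s := s) (a := a) le_rfl ha has) hst
  intro x hx
  show x ∈ s
  rw [← this]
  exact Submodule.mem_sup_left hx

end Maximal

theorem snd_mem_of_mem_source {E F G : Type*} [TopologicalSpace E] [TopologicalSpace F]
    [TopologicalSpace G] {e : OpenPartialHomeomorph E (G × F)} {V : Opens F}
    (hV : (V : Set F) = Prod.snd '' e.target) {p : E} (hp : p ∈ e.source) : (e p).2 ∈ V := by
  rw [← SetLike.mem_coe, hV]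
  exact ⟨e p, e.map_source hp, rfl⟩

/-! ### Related vector fields and reduced forms -/

section Related

variable {E F G : Type*} [NormedAddCommGroup E] [NormedSpace ℝ E] [NormedAddCommGroup F]
  [NormedSpace ℝ F] [NormedAddCommGroup G] [NormedSpace ℝ G]

/-- The commutators of `f`-related vector fields are `f`-related. -/
theorem fderiv_lieBracket_of_related {f : E → F} {p : E} (hf : ContDiffAt ℝ ∞ f p)
    {X₁ X₂ : E → E} {Y₁ Y₂ : F → F} (hX₁ : DifferentiableAt ℝ X₁ p)
    (hX₂ : DifferentiableAt ℝ X₂ p) (hY₁ : DifferentiableAt ℝ Y₁ (f p))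
    (hY₂ : DifferentiableAt ℝ Y₂ (f p))
    (h₁ : ∀ᶠ q in nhds p, fderiv ℝ f q (X₁ q) = Y₁ (f q))
    (h₂ : ∀ᶠ q in nhds p, fderiv ℝ f q (X₂ q) = Y₂ (f q)) :
    fderiv ℝ f p (lieBracket ℝ X₁ X₂ p) = lieBracket ℝ Y₁ Y₂ (f p) := by
  have hfd : DifferentiableAt ℝ f p := hf.differentiableAt (by simp)
  have e₁ : (fun q => fderiv ℝ f q (X₁ q)) =ᶠ[nhds p] Y₁ ∘ f := h₁
  have e₂ : (fun q => fderiv ℝ f q (X₂ q)) =ᶠ[nhds p] Y₂ ∘ f := h₂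
  -- The second derivative of `f` is symmetric and cancels from the bracket; this is where two
  -- derivatives of `f` are needed.
  rw [fderiv_apply_lieBracket hf (by
      rw [minSmoothness_of_isRCLikeNormedField]
      exact WithTop.coe_le_coe.2 (le_top : (2 : ℕ∞) ≤ ⊤)) hX₂ hX₁,
    e₁.fderiv_eq, e₂.fderiv_eq, fderiv_comp p hY₁ hfd, fderiv_comp p hY₂ hfd, lieBracket_eq]
  simp only [ContinuousLinearMap.comp_apply]
  rw [h₁.self_of_nhds, h₂.self_of_nhds]

variable {U : Opens E} {V : Opens F}

/-- In the coordinates `e = (s, y)`, the field `Y` on the space of the `y` is the reduced form of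
the field `X`. -/
def IsReducedForm (e : OpenPartialHomeomorph E (G × F)) (X : VF U) (Y : VF V) : Prop :=
  ∀ p ∈ e.source, (fderiv ℝ e p (X.1 p)).2 = Y.1 (e p).2

variable {e : OpenPartialHomeomorph E (G × F)}

theorem IsReducedForm.add {X₁ X₂ : VF U} {Y₁ Y₂ : VF V} (h₁ : IsReducedForm e X₁ Y₁)
    (h₂ : IsReducedForm e X₂ Y₂) : IsReducedForm e (X₁ + X₂) (Y₁ + Y₂) := fun p hp => by
  simp [h₁ p hp, h₂ p hp]

theorem IsReducedForm.smul {X : VF U} {Y : VF V} (c : ℝ) (h : IsReducedForm e X Y) :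
    IsReducedForm e (c • X) (c • Y) := fun p hp => by
  simp [h p hp]

/-- Each point of `V` is the second component of a chart value, so `X` prescribes `Y` everywhere on
`V`. -/
theorem IsReducedForm.unique (hV : (V : Set F) = Prod.snd '' e.target) {X : VF U} {Y₁ Y₂ : VF V}
    (h₁ : IsReducedForm e X Y₁) (h₂ : IsReducedForm e X Y₂) : Y₁ = Y₂ := by
  refine VF.ext_on fun y hy => ?_
  rw [← SetLike.mem_coe, hV] at hy
  obtain ⟨z, hz, rfl⟩ := hy
  have hp := e.map_target hz
  rw [← e.right_inv hz, ← h₁ _ hp, ← h₂ _ hp]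

/-- Being a reduced form means being related along `q ↦ (e q).2`, and relatedness passes to
commutators. -/
theorem IsReducedForm.lie (hU : e.source ⊆ U) (hV : (V : Set F) = Prod.snd '' e.target)
    (he : ContDiffOn ℝ ∞ e e.source) {X₁ X₂ : VF U} {Y₁ Y₂ : VF V} (h₁ : IsReducedForm e X₁ Y₁)
    (h₂ : IsReducedForm e X₂ Y₂) : IsReducedForm e ⁅X₁, X₂⁆ ⁅Y₁, Y₂⁆ := fun p hp => by
  have hc : ∀ q ∈ e.source, ContDiffAt ℝ ∞ e q := fun q hq =>
    he.contDiffAt (e.open_source.mem_nhds hq)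
  have hd : ∀ q ∈ e.source, ∀ v, fderiv ℝ (fun q => (e q).2) q v = (fderiv ℝ e q v).2 := by
    intro q hq v
    rw [fderiv.snd ((hc q hq).differentiableAt (by simp))]
    rfl
  have hpV := snd_mem_of_mem_source hV hp
  have hev := e.open_source.mem_nhds hp
  have := fderiv_lieBracket_of_related (f := fun q => (e q).2) (hc p hp).snd
    (differentiableAt_of_mem X₁ (hU hp)) (differentiableAt_of_mem X₂ (hU hp))
    (differentiableAt_of_mem Y₁ hpV) (differentiableAt_of_mem Y₂ hpV)
    (Filter.eventually_of_mem hev fun q hq => (hd q hq _).trans (h₁ q hq))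
    (Filter.eventually_of_mem hev fun q hq => (hd q hq _).trans (h₂ q hq))
  rw [hd p hp] at this
  exact this

/-- Uniqueness of reduced forms makes any choice of them additive, homogeneous and compatible with
brackets. -/
theorem exists_reductionHom (hU : e.source ⊆ U) (hV : (V : Set F) = Prod.snd '' e.target)
    (he : ContDiffOn ℝ ∞ e e.source) (kept : LieSubalgebra ℝ (VF U))
    (h : ∀ X ∈ kept, ∃ Y : VF V, IsReducedForm e X Y) :
    ∃ φ : kept →ₗ⁅ℝ⁆ VF V, ∀ X, IsReducedForm e X.1 (φ X) := by
  choose f hf using fun X : kept => h X.1 X.2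
  exact ⟨{ toFun := f
           map_add' := fun X Y => (hf (X + Y)).unique hV ((hf X).add (hf Y))
           map_smul' := fun c X => (hf (c • X)).unique hV ((hf X).smul c)
           map_lie' := fun {X Y} => (hf ⁅X, Y⁆).unique hV ((hf X).lie hU hV he (hf Y)) }, hf⟩

end Related

/-! ### The generators that a procedure uses -/

namespace Step

variable {S S' : Stage} {m : ℕ} (σ : Step S S' m)

theorem isReducedForm_Z (i : Fin m) : IsReducedForm σ.chart (σ.Z i) (0 : VF S'.U) := fun p hp => by
  rw [σ.normal_form p hp i]
  rfl

theorem exists_reduces_of_mem_spanOf {L : List (VF S.U)} {L' : List (VF S'.U)}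
    (h : List.Forall₂ σ.Reduces L L') {Y : VF S'.U} (hY : Y ∈ spanOf L') :
    ∃ X ∈ spanOf L, IsReducedForm σ.chart X Y := by
  have hmem : ∀ Y ∈ L', ∃ X ∈ L, IsReducedForm σ.chart X Y := by
    clear hY
    induction h with
    | nil => simp
    | cons h _ ih =>
      intro Y hY
      rcases List.mem_cons.1 hY with rfl | hY
      · exact ⟨_, List.mem_cons_self, h⟩
      · obtain ⟨X, hX, hXY⟩ := ih Y hY
        exact ⟨X, List.mem_cons_of_mem _ hX, hXY⟩
  induction hY using Submodule.span_induction with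
  | mem Y hY =>
    obtain ⟨X, hX, hXY⟩ := hmem Y hY
    exact ⟨X, Submodule.subset_span hX, hXY⟩
  | zero => exact ⟨0, zero_mem _, fun p _ => by simp⟩
  | add Y₁ Y₂ _ _ h₁ h₂ =>
    obtain ⟨X₁, hX₁, h₁⟩ := h₁
    obtain ⟨X₂, hX₂, h₂⟩ := h₂
    exact ⟨X₁ + X₂, add_mem hX₁ hX₂, h₁.add h₂⟩
  | smul c Y _ h =>
    obtain ⟨X, hX, h⟩ := h
    exact ⟨c • X, Submodule.smul_mem _ c hX, h.smul c⟩

theorem spanOf_append (L : List (VF S.U)) :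
    spanOf (List.ofFn σ.Z ++ L) = Submodule.span ℝ (range σ.Z) ⊔ spanOf L := by
  rw [spanOf, spanOf, ← Submodule.span_union]
  congr 1
  ext X
  simp [List.mem_ofFn]

end Step

theorem finiteDimensional_spanOf {E : Type*} [NormedAddCommGroup E] [NormedSpace ℝ E]
    {U : Opens E} (L : List (VF U)) : FiniteDimensional ℝ (spanOf L) :=
  FiniteDimensional.span_of_finite ℝ L.finite_toSet

/-- The generators that are used form a basis of a solvable subalgebra. -/
theorem Uses.exists_solvable {S : Stage} {L : List (VF S.U)} (h : Uses S L) :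
    ∃ t : LieSubalgebra ℝ (VF S.U), t ≤ S.gens ∧ LieAlgebra.IsSolvable t ∧
      spanOf L = t.toSubmodule ∧ L.length = Module.finrank ℝ t := by
  induction h with
  | nil S =>
    refine ⟨⊥, bot_le, ?_, ?_, ?_⟩
    · have : Subsingleton (⊥ : LieSubalgebra ℝ (VF S.U)) :=
        inferInstanceAs (Subsingleton (⊥ : Submodule ℝ (VF S.U)))
      exact LieAlgebra.IsSolvable.mk (R := ℝ) (k := 0) (Subsingleton.elim _ _)
    · simp [spanOf]
    · exact (finrank_bot ℝ (VF S.U)).symm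
  | @step S S' m σ L L' hL' hL hred ih =>
    obtain ⟨t', -, ht'solv, ht'span, ht'len⟩ := ih
    obtain ⟨φ, hφ⟩ := exists_reductionHom (V := S'.U) σ.source_subset σ.reduced_domain σ.smooth
      σ.kept fun X hX => (σ.reduce X hX).imp fun Y hY => hY.2
    have hφu : ∀ X : σ.kept, ∀ Y, IsReducedForm σ.chart X.1 Y → φ X = Y := fun X Y h =>
      (hφ X).unique σ.reduced_domain h
    -- The kernel of the reduction is the span of the `Z_i`; the inclusion from left to right is the
    -- normal form, the converse is `reduced_indep`.
    have hφZ : ∀ X : σ.kept, X.1 ∈ Submodule.span ℝ (range σ.Z) ↔ φ X = 0 := by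
      refine fun X => ⟨fun hX => hφu X 0 ?_, fun h => σ.reduced_indep X.1 X.2 fun p hp => ?_⟩
      · generalize X.1 = W at hX
        induction hX using Submodule.span_induction with
        | mem W hW =>
          obtain ⟨i, rfl⟩ := hW
          exact σ.isReducedForm_Z i
        | zero => exact fun p _ => by simp
        | add W₁ W₂ _ _ h₁ h₂ => simpa using h₁.add h₂
        | smul c W _ h => simpa using h.smul c
      · rw [hφ X p hp, h]
        rfl
    -- The preimage of `t'` under the reduction: an extension of `t'` by the span of the `Z_i`.
    let t : LieSubalgebra ℝ (VF S.U) := (t'.comap φ).map σ.kept.incl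
    have ht : ∀ X, X ∈ t ↔ ∃ h : X ∈ σ.kept, φ ⟨X, h⟩ ∈ t' := by
      intro X
      constructor
      · rintro ⟨⟨X, hX⟩, h, rfl⟩
        exact ⟨hX, h⟩
      · rintro ⟨hX, h⟩
        exact ⟨⟨X, hX⟩, h, rfl⟩
    have hspan : spanOf (List.ofFn σ.Z ++ L) = t.toSubmodule := by
      rw [σ.spanOf_append]
      refine le_antisymm (sup_le (Submodule.span_le.2 ?_) (Submodule.span_le.2 ?_)) ?_
      · rintro _ ⟨i, rfl⟩
        refine (ht _).2 ⟨σ.Z_mem i, ?_⟩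
        rw [(hφZ ⟨σ.Z i, σ.Z_mem i⟩).1 (Submodule.subset_span ⟨i, rfl⟩)]
        exact zero_mem _
      · intro X hX
        have : ∃ Y ∈ L', σ.Reduces X Y := by
          clear * - hX hred
          induction hred with
          | nil => simp at hX
          | cons h _ ih =>
            rcases List.mem_cons.1 hX with rfl | hX
            · exact ⟨_, List.mem_cons_self, h⟩
            · obtain ⟨Y, hY, hXY⟩ := ih hX
              exact ⟨Y, List.mem_cons_of_mem _ hY, hXY⟩
        obtain ⟨Y, hY, hXY⟩ := this
        refine (ht _).2 ⟨hL X hX, ?_⟩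
        rw [hφu ⟨X, hL X hX⟩ Y hXY, ← LieSubalgebra.mem_toSubmodule, ← ht'span]
        exact Submodule.subset_span hY
      · intro X hX
        obtain ⟨hXk, hX⟩ := (ht X).1 hX
        rw [← LieSubalgebra.mem_toSubmodule, ← ht'span] at hX
        -- `X` and a combination `W` of `L` with the same reduced form differ by an element of the
        -- kernel.
        obtain ⟨W, hW, hWX⟩ := σ.exists_reduces_of_mem_spanOf hred hX
        have hWk : W ∈ σ.kept := (Submodule.span_le.2 hL : spanOf L ≤ σ.kept.toSubmodule) hW
        have h0 : φ (⟨X, hXk⟩ - ⟨W, hWk⟩) = 0 := by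
          rw [map_sub, hφu ⟨W, hWk⟩ _ hWX, sub_self]
        rw [← sub_add_cancel X W]
        exact Submodule.add_mem_sup ((hφZ _).2 h0) hW
    let ψ : t →ₗ⁅ℝ⁆ t' :=
      { toFun := fun X => ⟨φ ⟨X.1, ((ht _).1 X.2).1⟩, ((ht _).1 X.2).2⟩
        map_add' := fun X Y => Subtype.ext
          (map_add φ ⟨X.1, ((ht _).1 X.2).1⟩ ⟨Y.1, ((ht _).1 Y.2).1⟩)
        map_smul' := fun c X => Subtype.ext (map_smul φ c ⟨X.1, ((ht _).1 X.2).1⟩)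
        map_lie' := fun {X Y} =>
          Subtype.ext (LieHom.map_lie φ ⟨X.1, ((ht _).1 X.2).1⟩ ⟨Y.1, ((ht _).1 Y.2).1⟩) }
    have hψ : ∀ X : t, ψ X = 0 ↔ X.1 ∈ Submodule.span ℝ (range σ.Z) := fun X =>
      Subtype.ext_iff.trans (hφZ ⟨X.1, ((ht _).1 X.2).1⟩).symm
    have hZt : Submodule.span ℝ (range σ.Z) ≤ t.toSubmodule := by
      rw [← hspan, σ.spanOf_append]
      exact le_sup_left
    refine ⟨t, ?_, ?_, hspan, ?_⟩
    · exact fun X hX => σ.kept_le ((ht X).1 hX).1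
    · have : LieAlgebra.IsSolvable ψ.ker := by
        have : IsLieAbelian ψ.ker := ⟨fun X Y => Subtype.ext <| Subtype.ext <|
          lie_eq_zero_of_mem_span σ.abelian ((hψ _).1 X.2) ((hψ _).1 Y.2)⟩
        infer_instance
      exact isSolvable_of_isSolvable_ker ψ
    · have hfd : FiniteDimensional ℝ t.toSubmodule := by
        rw [← hspan]
        exact finiteDimensional_spanOf _
      have hfd' : FiniteDimensional ℝ t := hfd
      have hsurj : Function.Surjective ψ := by
        rintro ⟨Y, hY⟩
        have hY' := hY
        rw [← LieSubalgebra.mem_toSubmodule, ← ht'span] at hY'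
        obtain ⟨X, hX, hXY⟩ := σ.exists_reduces_of_mem_spanOf hred hY'
        have hXk : X ∈ σ.kept := (Submodule.span_le.2 hL : spanOf L ≤ σ.kept.toSubmodule) hX
        have := hφu ⟨X, hXk⟩ Y hXY
        exact ⟨⟨X, (ht X).2 ⟨hXk, by rwa [this]⟩⟩, Subtype.ext this⟩
      have hker : Module.finrank ℝ ψ.toLinearMap.ker = m := by
        have : ψ.toLinearMap.ker.map t.toSubmodule.subtype = Submodule.span ℝ (range σ.Z) := by
          ext X
          constructor
          · rintro ⟨X, hX, rfl⟩
            exact (hψ X).1 hX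
          · exact fun hX => ⟨⟨X, hZt hX⟩, (hψ _).2 hX, rfl⟩
        have h := Submodule.finrank_map_subtype_eq t.toSubmodule ψ.toLinearMap.ker
        rw [this] at h
        refine h.symm.trans ?_
        rw [finrank_span_eq_card σ.Z_indep,
          Fintype.card_fin]
      -- Rank–nullity for `t → t'`: the `m` new generators account exactly for the kernel.
      have := ψ.toLinearMap.finrank_range_add_finrank_ker
      rw [LinearMap.range_eq_top.2 hsurj, finrank_top, hker] at this
      rw [List.length_append, List.length_ofFn, hred.length_eq, ht'len, add_comm]
      exact this

/-! ### The inverse function theorem for smooth functions -/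

/-- Invertibility of the derivative is an open condition. Restricting the local inverse to the
points where it holds makes the inverse smooth on the whole target. Completeness suffices, so the
result applies to spaces of paths. -/
theorem exists_openPartialHomeomorph_contDiffOn {X Y : Type*} [NormedAddCommGroup X]
    [NormedSpace ℝ X] [CompleteSpace X] [NormedAddCommGroup Y] [NormedSpace ℝ Y] {f : X → Y}
    {O : Set X} (hO : IsOpen O) {a : X} (ha : a ∈ O) (hf : ContDiffOn ℝ ∞ f O) (e : X ≃L[ℝ] Y)
    (he : HasFDerivAt f (e : X →L[ℝ] Y) a) :
    ∃ h : OpenPartialHomeomorph X Y, (⇑h = f) ∧ a ∈ h.source ∧ h.source ⊆ O ∧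
      ContDiffOn ℝ ∞ h.symm h.target := by
  have hfa : ∀ x ∈ O, ContDiffAt ℝ ∞ f x := fun x hx => hf.contDiffAt (hO.mem_nhds hx)
  have hc : ContinuousOn (fderiv ℝ f) O := hf.continuousOn_fderiv_of_isOpen hO (by simp)
  have hO' := hc.isOpen_inter_preimage hO
    (ContinuousLinearEquiv.isOpen (𝕜 := ℝ) (E := X) (F := Y))
  let h₀ := ContDiffAt.toOpenPartialHomeomorph f (hfa a ha) he (by simp)
  refine ⟨h₀.restrOpen _ hO', rfl,
    ⟨ContDiffAt.mem_toOpenPartialHomeomorph_source (hfa a ha) he (by simp), ha, e, he.fderiv.symm⟩,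
    fun x hx => hx.2.1, fun y hy => ?_⟩
  obtain ⟨-, hxO, e', he'⟩ := (h₀.restrOpen _ hO').map_target hy
  have hx := hfa _ hxO
  refine ((h₀.restrOpen _ hO').contDiffAt_symm (f₀' := e') hy ?_ hx).contDiffWithinAt
  rw [he']
  exact (hx.differentiableAt (by simp)).hasFDerivAt

/-! ### Superposition operators -/

section Superposition

universe u

variable {K : Type*} [TopologicalSpace K] [CompactSpace K]
variable {E F : Type u} [NormedAddCommGroup E] [NormedSpace ℝ E] [NormedAddCommGroup F]
  [NormedSpace ℝ F]

/-- Pointwise evaluation of a continuous family of operators. -/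
noncomputable def pointwiseApply : C(K, E →L[ℝ] F) →L[ℝ] C(K, E) →L[ℝ] C(K, F) :=
  LinearMap.mkContinuous₂
    (LinearMap.mk₂ ℝ (fun (A : C(K, E →L[ℝ] F)) (γ : C(K, E)) =>
        (⟨fun τ => A τ (γ τ), A.continuous.clm_apply γ.continuous⟩ : C(K, F)))
      (fun A B γ => by ext; simp) (fun c A γ => by ext; simp)
      (fun A γ δ => by ext; simp) (fun c A γ => by ext; simp)) 1
    (fun A γ => by
      rw [one_mul]
      refine (ContinuousMap.norm_le _ (by positivity)).2 fun τ => ?_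
      exact (A τ).le_of_opNorm_le_of_le (A.norm_coe_le_norm τ) (γ.norm_coe_le_norm τ))

@[simp]
theorem pointwiseApply_apply (A : C(K, E →L[ℝ] F)) (γ : C(K, E)) (τ : K) :
    pointwiseApply A γ τ = A τ (γ τ) := rfl

/-- The range of `γ` is compact, so `f'` is uniformly continuous near it, and the mean value
inequality gives a remainder bound uniform in the parameter. -/
theorem hasFDerivAt_superposition {f : C(E, F)} {f' : C(E, E →L[ℝ] F)}
    (hf : ∀ x, HasFDerivAt f (f' x) x) (γ : C(K, E)) :
    HasFDerivAt (fun γ : C(K, E) => f.comp γ) (pointwiseApply (f'.comp γ)) γ := by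
  refine HasFDerivAt.of_isLittleO (Asymptotics.isLittleO_iff.2 fun ε hε => ?_)
  have hK : IsCompact (range γ) := isCompact_range γ.continuous
  have hu := hK.uniformContinuousAt_of_continuousAt f' (fun x _ => f'.continuous.continuousAt)
    (Metric.dist_mem_uniformity hε)
  obtain ⟨δ, hδ, hu⟩ := Metric.mem_uniformity_dist.1 hu
  filter_upwards [Metric.ball_mem_nhds γ hδ] with γ' hγ'
  rw [ContinuousMap.norm_le _ (by positivity)]
  intro τ
  have hd : dist (γ' τ) (γ τ) < δ := (ContinuousMap.dist_apply_le_dist τ).trans_lt hγ'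
  have hmv := (convex_ball (γ τ) δ).norm_image_sub_le_of_norm_hasFDerivWithin_le'
    (f := f) (f' := f') (φ := f' (γ τ)) (C := ε) (fun x _ => (hf x).hasFDerivWithinAt)
    (fun x hx => by
      have := hu (a := γ τ) (b := x) (by rw [dist_comm]; exact hx) ⟨τ, rfl⟩
      simp only [mem_ofPred_eq] at this
      rw [dist_comm, dist_eq_norm] at this
      exact this.le)
    (Metric.mem_ball_self hδ) (y := γ' τ) hd
  exact hmv.trans (mul_le_mul_of_nonneg_left ((γ' - γ).norm_coe_le_norm τ) hε.le)

/-- The derivative is again a superposition operator, by `f'`, followed by a bounded linear map. The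
induction therefore varies the spaces, and a common universe keeps `E →L[ℝ] F` within its reach. -/
theorem contDiff_nat_superposition (n : ℕ) : ∀ {E F : Type u} [NormedAddCommGroup E]
    [NormedSpace ℝ E] [NormedAddCommGroup F] [NormedSpace ℝ F] (f : C(E, F)),
    ContDiff ℝ n f → ContDiff ℝ n fun γ : C(K, E) => f.comp γ := by
  induction n with
  | zero =>
    intro E F _ _ _ _ f _
    exact contDiff_zero.2 (ContinuousMap.continuous_postcomp f)
  | succ n ih =>
    intro E F _ _ _ _ f hf
    push_cast at hf ⊢
    obtain ⟨f', hf'c, hf'⟩ := contDiff_succ_iff_hasFDerivAt.1 hf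
    exact contDiff_succ_iff_hasFDerivAt.2 ⟨_, (pointwiseApply (K := K)).contDiff.comp
      (ih ⟨f', hf'c.continuous⟩ hf'c), hasFDerivAt_superposition (f' := ⟨f', hf'c.continuous⟩) hf'⟩

theorem contDiff_superposition {f : C(E, F)} (hf : ContDiff ℝ ∞ f) :
    ContDiff ℝ ∞ fun γ : C(K, E) => f.comp γ :=
  contDiff_infty.2 fun n => contDiff_nat_superposition n f (contDiff_infty.1 hf n)

end Superposition

/-! ### The primitive of a path -/

section Primitive

variable {E : Type*} [NormedAddCommGroup E]

/-- A path on `[0, 1]`, extended by constants to the real line. -/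
noncomputable def extendPath (γ : C(Icc (0 : ℝ) 1, E)) : ℝ → E := fun σ =>
  γ (projIcc 0 1 zero_le_one σ)

theorem continuous_extendPath (γ : C(Icc (0 : ℝ) 1, E)) : Continuous (extendPath γ) :=
  γ.continuous.comp continuous_projIcc

theorem extendPath_of_mem (γ : C(Icc (0 : ℝ) 1, E)) {σ : ℝ} (hσ : σ ∈ Icc (0 : ℝ) 1) :
    extendPath γ σ = γ ⟨σ, hσ⟩ := by
  rw [extendPath, projIcc_of_mem zero_le_one hσ]

theorem intervalIntegrable_extendPath (γ : C(Icc (0 : ℝ) 1, E)) (a b : ℝ) :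
    IntervalIntegrable (extendPath γ) MeasureTheory.volume a b :=
  (continuous_extendPath γ).intervalIntegrable a b

variable [NormedSpace ℝ E]

/-- The operator `γ ↦ (τ ↦ ∫_0^τ γ)` on the space of paths. -/
noncomputable def primitive : C(Icc (0 : ℝ) 1, E) →L[ℝ] C(Icc (0 : ℝ) 1, E) :=
  LinearMap.mkContinuous
    { toFun := fun γ => ⟨fun τ => ∫ σ in (0 : ℝ)..τ, extendPath γ σ,
        (intervalIntegral.continuous_primitive (intervalIntegrable_extendPath γ) 0).comp
          continuous_subtype_val⟩
      map_add' := fun γ δ => by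
        ext τ
        exact intervalIntegral.integral_add (intervalIntegrable_extendPath γ 0 τ)
          (intervalIntegrable_extendPath δ 0 τ)
      map_smul' := fun c γ => by
        ext τ
        exact intervalIntegral.integral_smul c (extendPath γ) } 1
    (fun γ => by
      rw [one_mul, ContinuousMap.norm_le _ (norm_nonneg _)]
      intro τ
      refine (intervalIntegral.norm_integral_le_of_norm_le_const (C := ‖γ‖)
        fun σ _ => γ.norm_coe_le_norm _).trans ?_
      rw [sub_zero, abs_of_nonneg τ.2.1]
      exact mul_le_of_le_one_right (norm_nonneg _) τ.2.2)

theorem primitive_apply (γ : C(Icc (0 : ℝ) 1, E)) (τ : Icc (0 : ℝ) 1) :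
    primitive γ τ = ∫ σ in (0 : ℝ)..τ, extendPath γ σ := rfl

theorem hasDerivAt_integral_extendPath [CompleteSpace E] (γ : C(Icc (0 : ℝ) 1, E)) (τ : ℝ) :
    HasDerivAt (fun τ => ∫ σ in (0 : ℝ)..τ, extendPath γ σ) (extendPath γ τ) τ :=
  intervalIntegral.integral_hasDerivAt_right (intervalIntegrable_extendPath γ 0 τ)
    ((continuous_extendPath γ).stronglyMeasurableAtFilter _ _) (continuous_extendPath γ).continuousAt

end Primitive

/-! ### The joint flow of commuting vector fields -/

section Flow

variable {E : Type*} [NormedAddCommGroup E] [NormedSpace ℝ E] {m : ℕ}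

/-- The constant paths. -/
noncomputable def constPath : E →L[ℝ] C(Icc (0 : ℝ) 1, E) :=
  ContinuousLinearMap.const ℝ (Icc (0 : ℝ) 1)

@[simp]
theorem constPath_apply (q : E) (τ : Icc (0 : ℝ) 1) : constPath q τ = q := rfl

/-- The integral equation `γ = q + ∫ ∑_i s_i Z_i(γ)` for the path that leads from `q` to
`exp(∑_i s_i Z_i) q`, as a map whose zeros in the last component are the solutions. -/
noncomputable def flowEquation (Z : Fin m → C(E, E))
    (x : ((Fin m → ℝ) × E) × C(Icc (0 : ℝ) 1, E)) : ((Fin m → ℝ) × E) × C(Icc (0 : ℝ) 1, E) :=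
  (x.1, x.2 - constPath x.1.2
    - primitive (∑ i, x.1.1 i • (Z i).comp x.2))

theorem contDiff_flowEquation {Z : Fin m → C(E, E)} (hZ : ∀ i, ContDiff ℝ ∞ (Z i)) :
    ContDiff ℝ ∞ (flowEquation Z) := by
  refine contDiff_fst.prodMk ((contDiff_snd.sub ?_).sub ((primitive (E := E)).contDiff.comp ?_))
  · exact (constPath (E := E)).contDiff.comp (contDiff_snd.comp contDiff_fst)
  · refine ContDiff.sum fun i _ => ContDiff.fun_smul ?_ ?_
    · exact (contDiff_apply ℝ ℝ i).comp (contDiff_fst.comp contDiff_fst)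
    · exact (contDiff_superposition (hZ i)).comp contDiff_snd

theorem hasFDerivAt_flowEquation {Z : Fin m → C(E, E)} {Z' : Fin m → C(E, E →L[ℝ] E)}
    (hZ : ∀ i x, HasFDerivAt (Z i) (Z' i x) x) (x : ((Fin m → ℝ) × E) × C(Icc (0 : ℝ) 1, E)) :
    HasFDerivAt (flowEquation Z) ((ContinuousLinearMap.fst ℝ _ _).prod
      (ContinuousLinearMap.snd ℝ _ _ - (constPath (E := E)).comp
        ((ContinuousLinearMap.snd ℝ _ _).comp (ContinuousLinearMap.fst ℝ _ _))
        - primitive.comp (∑ i, (x.1.1 i • (pointwiseApply ((Z' i).comp x.2)).comp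
            (ContinuousLinearMap.snd ℝ _ _) +
          (((ContinuousLinearMap.proj i).comp (ContinuousLinearMap.fst ℝ (Fin m → ℝ) E)).comp
            (ContinuousLinearMap.fst ℝ _ _)).smulRight ((Z i).comp x.2))))) x := by
  let P := ContinuousLinearMap.fst ℝ ((Fin m → ℝ) × E) C(Icc (0 : ℝ) 1, E)
  have h1 : ∀ i, HasFDerivAt (fun x : ((Fin m → ℝ) × E) × C(Icc (0 : ℝ) 1, E) => x.1.1 i)
      (((ContinuousLinearMap.proj i).comp (ContinuousLinearMap.fst ℝ (Fin m → ℝ) E)).comp P) x :=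
    fun i => (((ContinuousLinearMap.proj i).comp
      (ContinuousLinearMap.fst ℝ (Fin m → ℝ) E)).comp P).hasFDerivAt
  have h2 : ∀ i, HasFDerivAt (fun x : ((Fin m → ℝ) × E) × C(Icc (0 : ℝ) 1, E) => (Z i).comp x.2)
      ((pointwiseApply ((Z' i).comp x.2)).comp (ContinuousLinearMap.snd ℝ _ _)) x :=
    fun i => (hasFDerivAt_superposition (hZ i) x.2).comp x hasFDerivAt_snd
  have h3 : HasFDerivAt (fun x : ((Fin m → ℝ) × E) × C(Icc (0 : ℝ) 1, E) => constPath x.1.2)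
      ((constPath (E := E)).comp ((ContinuousLinearMap.snd ℝ _ _).comp P)) x :=
    ((constPath (E := E)).comp ((ContinuousLinearMap.snd ℝ (Fin m → ℝ) E).comp P)).hasFDerivAt
  exact hasFDerivAt_fst.prodMk ((hasFDerivAt_snd.sub h3).sub
    ((primitive (E := E)).hasFDerivAt.comp x
      (HasFDerivAt.fun_sum fun i _ => (h1 i).fun_smul (h2 i))))

/-- A path that solves the integral equation of the joint flow satisfies the linearized equation
with the variation `τ ↦ τ Z_i(γ(τ))`. -/
theorem primitive_variation [CompleteSpace E] {Z : Fin m → C(E, E)} {Z' : Fin m → C(E, E →L[ℝ] E)}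
    (hZ : ∀ i x, HasFDerivAt (Z i) (Z' i x) x) {s : Fin m → ℝ} {q : E} {γ : C(Icc (0 : ℝ) 1, E)}
    (hγ : γ = constPath q + primitive (∑ i, s i • (Z i).comp γ))
    (i : Fin m) (hcomm : ∀ τ j, Z' i (γ τ) (Z j (γ τ)) = Z' j (γ τ) (Z i (γ τ)))
    {w : C(Icc (0 : ℝ) 1, E)} (hw : ∀ τ, w τ = (τ : ℝ) • Z i (γ τ)) :
    w = primitive ((Z i).comp γ + ∑ j, s j • pointwiseApply ((Z' j).comp γ) w) := by
  set k : C(Icc (0 : ℝ) 1, E) := ∑ i, s i • (Z i).comp γ with hk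
  -- The path prolonged to the whole line, so that two-sided derivatives exist at the endpoints as
  -- well.
  let c : ℝ → E := fun σ => q + ∫ ρ in (0 : ℝ)..σ, extendPath k ρ
  have hc : ∀ σ, HasDerivAt c (extendPath k σ) σ := fun σ =>
    (hasDerivAt_integral_extendPath k σ).const_add q
  have hcγ : ∀ (σ : ℝ) (hσ : σ ∈ Icc (0 : ℝ) 1), c σ = γ ⟨σ, hσ⟩ := by
    intro σ hσ
    rw [hγ]
    rfl
  ext τ
  rw [primitive_apply, intervalIntegral.integral_eq_sub_of_hasDerivAt
    (f := fun σ => σ • Z i (c σ)) ?_ (intervalIntegrable_extendPath _ _ _)]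
  · simp only [zero_smul, sub_zero]
    rw [hw, hcγ τ τ.2]
  · intro σ hσ
    rw [uIcc_of_le τ.2.1] at hσ
    have hσ' : σ ∈ Icc (0 : ℝ) 1 := ⟨hσ.1, hσ.2.trans τ.2.2⟩
    -- The derivative of `σ Z_i(c)` is `Z_i + σ ∑_j s_j Z_i' Z_j`; commutation replaces `Z_i' Z_j`
    -- by `Z_j' Z_i`, which yields the linearized equation.
    have h1 := (hasDerivAt_id σ).smul ((hZ i (c σ)).comp_hasDerivAt σ (hc σ))
    refine h1.congr_deriv ?_
    rw [extendPath_of_mem _ hσ', extendPath_of_mem _ hσ', hcγ σ hσ']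
    simp only [hk, ContinuousMap.add_apply, ContinuousMap.sum_apply, ContinuousMap.smul_apply,
      ContinuousMap.comp_apply, pointwiseApply_apply, hw, map_sum, map_smul, id, one_smul,
      Finset.smul_sum, hcomm]
    rw [add_comm]
    congr 1
    · simp [Function.comp, hcγ σ hσ']
    · exact Finset.sum_congr rfl fun j _ => smul_comm _ _ _

/-- Inverting `flowEquation` near `s = 0` and the constant path gives solution paths that depend
smoothly on `(s, q)`; the flow is their endpoint. Its `s^i`-derivative is the endpoint of the unique
solution of the linearized equation, which is `τ ↦ τ Z_i(γ(τ))`. -/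
theorem exists_flow_of_global [CompleteSpace E] {Z : Fin m → C(E, E)} (hZ : ∀ i, ContDiff ℝ ∞ (Z i))
    {O : Set E} (hO : IsOpen O) {p : E} (hp : p ∈ O)
    (hcomm : ∀ i j, ∀ x ∈ O, fderiv ℝ (Z i) x (Z j x) = fderiv ℝ (Z j) x (Z i x)) :
    ∃ (Φ : (Fin m → ℝ) × E → E) (W : Set ((Fin m → ℝ) × E)), IsOpen W ∧ (0, p) ∈ W ∧
      ContDiffOn ℝ ∞ Φ W ∧ (∀ z ∈ W, Φ z ∈ O) ∧ (∀ q, (0, q) ∈ W → Φ (0, q) = q) ∧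
      ∀ z ∈ W, ∀ i, fderiv ℝ Φ z (Pi.single i 1, 0) = Z i (Φ z) := by
  let Z' : Fin m → C(E, E →L[ℝ] E) := fun i => ⟨fderiv ℝ (Z i), (hZ i).continuous_fderiv (by simp)⟩
  have hZ' : ∀ i x, HasFDerivAt (Z i) (Z' i x) x := fun i x =>
    ((hZ i).differentiable (by simp) x).hasFDerivAt
  let p' : C(Icc (0 : ℝ) 1, E) := constPath p
  -- At `s = 0` the terms with `Z_i'` drop out, so the derivative is the identity plus a triangular
  -- part `T`, hence invertible.
  let T : (Fin m → ℝ) × E →L[ℝ] C(Icc (0 : ℝ) 1, E) :=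
    - (constPath (E := E)).comp (ContinuousLinearMap.snd ℝ _ _)
      - primitive.comp (∑ i, ((ContinuousLinearMap.proj i).comp
          (ContinuousLinearMap.fst ℝ (Fin m → ℝ) E)).smulRight ((Z i).comp p'))
  obtain ⟨h, hcoe, hmem, -, hsymm⟩ := exists_openPartialHomeomorph_contDiffOn isOpen_univ
    (mem_univ ((0, p), p')) (contDiff_flowEquation hZ).contDiffOn
    (ContinuousLinearEquiv.skewProd (.refl ℝ _) (.refl ℝ _) T) (by
      refine (hasFDerivAt_flowEquation hZ' ((0, p), p')).congr_fderiv ?_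
      ext <;> simp [T])
  have hval : h ((0, p), p') = ((0, p), 0) := by
    rw [hcoe, flowEquation]
    simp [p']
  have hvals : h.symm ((0, p), 0) = ((0, p), p') := by rw [← hval, h.left_inv hmem]
  have hmemt : ((0, p), 0) ∈ h.target := by
    rw [← hval]
    exact h.map_source hmem
  let g : (Fin m → ℝ) × E → ((Fin m → ℝ) × E) × C(Icc (0 : ℝ) 1, E) := fun z => h.symm (z, 0)
  let W₀ : Set ((Fin m → ℝ) × E) := {z | (z, 0) ∈ h.target}
  have hW₀ : IsOpen W₀ := h.open_target.preimage (by fun_prop)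
  have hg : ContDiffOn ℝ ∞ g W₀ := hsymm.comp (contDiff_id.prodMk contDiff_const).contDiffOn
    fun z hz => hz
  -- The fields commute only on `O`, so the whole path must stay there; compactness of `[0, 1]`
  -- makes this an open condition.
  have hN : IsOpen {x : ((Fin m → ℝ) × E) × C(Icc (0 : ℝ) 1, E) | MapsTo x.2 univ O} :=
    (ContinuousMap.isOpen_setOfPred_mapsTo isCompact_univ hO).preimage continuous_snd
  let W := W₀ ∩ g ⁻¹' {x | MapsTo x.2 univ O}
  have hW : IsOpen W := hg.continuousOn.isOpen_inter_preimage hW₀ hN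
  have heq : ∀ z ∈ W, flowEquation Z (g z) = (z, 0) := fun z hz => by
    rw [← hcoe]
    exact h.right_inv hz.1
  have hg1 : ∀ z ∈ W, (g z).1 = z := fun z hz => congrArg Prod.fst (heq z hz)
  have hg2 : ∀ z ∈ W, (g z).2 = constPath z.2
      + primitive (∑ i, z.1 i • (Z i).comp (g z).2) := fun z hz => by
    have := congrArg Prod.snd (heq z hz)
    simp only [flowEquation, hg1 z hz] at this
    rw [← sub_eq_zero, ← this]
    abel
  let one : Icc (0 : ℝ) 1 := ⟨1, zero_le_one, le_rfl⟩
  refine ⟨fun z => (g z).2 one, W, hW, ⟨hmemt, ?_⟩, ?_, fun z hz => hz.2 (mem_univ _),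
    fun q hq => ?_, fun z hz i => ?_⟩
  · intro τ _
    simp only [g, hvals]
    exact hp
  · exact (ContinuousMap.evalCLM ℝ one).contDiff.comp_contDiffOn
      (contDiff_snd.comp_contDiffOn (hg.mono inter_subset_left))
  · have := hg2 _ hq
    simp only [Pi.zero_apply, zero_smul, Finset.sum_const_zero, map_zero, add_zero] at this
    simp only [this]
    rfl
  · have hgd : HasFDerivAt g (fderiv ℝ g z) z :=
      (((hg.mono inter_subset_left).contDiffAt (hW.mem_nhds hz)).differentiableAt
        (by simp)).hasFDerivAt
    let w : C(Icc (0 : ℝ) 1, E) := ⟨fun τ => (τ : ℝ) • Z i ((g z).2 τ), by fun_prop⟩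
    have hw := primitive_variation (w := w) hZ' (hg2 z hz) i
      (fun τ j => hcomm i j _ (hz.2 (mem_univ τ))) fun τ => rfl
    have hsd : HasFDerivAt h.symm (fderiv ℝ h.symm (z, 0)) (z, 0) :=
      ((hsymm.contDiffAt (h.open_target.mem_nhds hz.1)).differentiableAt (by simp)).hasFDerivAt
    have hF := hasFDerivAt_flowEquation hZ' (g z)
    have hgs : g z ∈ h.source := h.map_target hz.1
    have hid : HasFDerivAt (fun x => h.symm (flowEquation Z x)) (.id ℝ _) (g z) :=
      (hasFDerivAt_id (g z)).congr_of_eventuallyEq <|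
        Filter.eventually_of_mem (h.open_source.mem_nhds hgs) fun x hx => by
          rw [← hcoe]
          exact h.left_inv hx
    rw [← heq z hz] at hsd
    have huniq := (hsd.comp (g z) hF).unique hid
    have hgz : HasFDerivAt g ((fderiv ℝ h.symm (z, 0)).comp
        ((ContinuousLinearMap.id ℝ _).prod 0)) z := by
      rw [heq z hz] at hsd
      exact hsd.comp z ((hasFDerivAt_id z).prodMk (hasFDerivAt_const _ _))
    -- The derivative of `flowEquation` sends `((e_i, 0), w)` to `((e_i, 0), 0)`; applying the
    -- derivative of the inverse recovers `w`.
    have hdir : fderiv ℝ g z (Pi.single i 1, 0) = ((Pi.single i 1, 0), w) := by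
      have h2 := DFunLike.congr_fun huniq (((Pi.single i 1, 0), w) : _ × _)
      rw [hgz.fderiv]
      refine Eq.trans ?_ h2
      simp only [ContinuousLinearMap.comp_apply, heq z hz]
      congr 1
      refine Prod.ext rfl ?_
      simp only [ContinuousLinearMap.prod_apply, sub_apply,
        ContinuousLinearMap.comp_apply, ContinuousLinearMap.coe_fst', ContinuousLinearMap.coe_snd',
        map_zero, sub_zero, zero_apply, hg1 z hz]
      rw [eq_comm, sub_eq_zero]
      refine hw.trans ?_
      congr 1
      simp only [sum_apply, add_apply, smul_apply,
        ContinuousLinearMap.comp_apply, ContinuousLinearMap.coe_snd', ContinuousLinearMap.coe_fst',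
        ContinuousLinearMap.smulRight_apply, ContinuousLinearMap.proj_apply,
        Finset.sum_add_distrib, Pi.single_apply, ite_smul, one_smul, zero_smul,
        Finset.sum_ite_eq', Finset.mem_univ, if_true]
      exact add_comm _ _
    have hΦ := ((ContinuousMap.evalCLM ℝ one).comp (ContinuousLinearMap.snd ℝ _ _)).hasFDerivAt.comp
      z hgd
    have hΦ' := hΦ.fderiv
    have : fderiv ℝ (fun z => (g z).2 one) z (Pi.single i 1, 0) = w one := by
      refine (DFunLike.congr_fun hΦ' _).trans ?_
      rw [ContinuousLinearMap.comp_apply, hdir]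
      rfl
    rw [this]
    simp [w, one]

/-- The joint flow `Φ(s, q) = exp(∑_i s_i Z_i) q` of commuting vector fields. -/
theorem exists_flow [FiniteDimensional ℝ E] {Z : Fin m → E → E} {O : Set E} (hO : IsOpen O) {p : E}
    (hp : p ∈ O) (hZ : ∀ i, ContDiffOn ℝ ∞ (Z i) O)
    (hcomm : ∀ i j, ∀ x ∈ O, fderiv ℝ (Z i) x (Z j x) = fderiv ℝ (Z j) x (Z i x)) :
    ∃ (Φ : (Fin m → ℝ) × E → E) (W : Set ((Fin m → ℝ) × E)), IsOpen W ∧ (0, p) ∈ W ∧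
      ContDiffOn ℝ ∞ Φ W ∧ (∀ z ∈ W, Φ z ∈ O) ∧ (∀ q, (0, q) ∈ W → Φ (0, q) = q) ∧
      ∀ z ∈ W, ∀ i, fderiv ℝ Φ z (Pi.single i 1, 0) = Z i (Φ z) := by
  obtain ⟨r, hr, hrO⟩ := Metric.isOpen_iff.1 hO p hp
  -- The cut-off makes the fields global and leaves them unchanged on the ball of radius `r / 4`, to
  -- which the flow is confined.
  let f : ContDiffBump p := ⟨r / 4, r / 2, by positivity, by linarith⟩
  have hfO : Metric.closedBall p f.rOut ⊆ O :=
    (Metric.closedBall_subset_ball (show r / 2 < r by linarith)).trans hrO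
  have hsmooth : ∀ i, ContDiff ℝ ∞ fun x => f x • Z i x := fun i => by
    refine contDiff_iff_contDiffAt.2 fun x => ?_
    by_cases hx : x ∈ O
    · exact f.contDiff.contDiffAt.smul ((hZ i).contDiffAt (hO.mem_nhds hx))
    · have hx' : x ∈ (Metric.closedBall p f.rOut)ᶜ := fun h => hx (hfO h)
      refine (contDiffAt_const (c := (0 : E))).congr_of_eventuallyEq ?_
      filter_upwards [Metric.isClosed_closedBall.isOpen_compl.mem_nhds hx'] with y hy
      rw [f.zero_of_le_dist (not_le.1 fun h => hy h).le, zero_smul]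
  have heq : ∀ i, ∀ x ∈ Metric.ball p (r / 4), (fun x => f x • Z i x) =ᶠ[nhds x] Z i := fun i x hx => by
    filter_upwards [Metric.isOpen_ball.mem_nhds hx] with y hy
    rw [f.one_of_mem_closedBall (Metric.ball_subset_closedBall hy), one_smul]
  have hball : Metric.ball p (r / 4) ⊆ O :=
    (Metric.ball_subset_ball (by linarith)).trans hrO
  obtain ⟨Φ, W, hW, hpW, hΦ, hΦO, hΦ0, hΦZ⟩ := exists_flow_of_global
    (Z := fun i => ⟨fun x => f x • Z i x, (hsmooth i).continuous⟩) hsmooth Metric.isOpen_ball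
    (Metric.mem_ball_self (x := p) (show 0 < r / 4 by positivity)) (fun i j x hx => by
      simp only [ContinuousMap.coe_mk]
      rw [(heq i x hx).fderiv_eq, (heq j x hx).fderiv_eq,
        f.one_of_mem_closedBall (Metric.ball_subset_closedBall hx), one_smul, one_smul]
      exact hcomm i j x (hball hx))
  exact ⟨Φ, W, hW, hpW, hΦ, fun z hz => hball (hΦO z hz), hΦ0, fun z hz i =>
    (hΦZ z hz i).trans (heq i _ (hΦO z hz)).self_of_nhds⟩

end Flow

/-! ### Simultaneous normal form of commuting vector fields -/

section Straightening

variable {E F : Type*} [NormedAddCommGroup E] [NormedSpace ℝ E] [NormedAddCommGroup F]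
  [NormedSpace ℝ F] {m : ℕ}

/-- `Φ` is the joint flow of the fields `Z_i` on the open set `W`. -/
structure IsFlow (Z : Fin m → E → E) (O : Set E) (W : Set ((Fin m → ℝ) × E))
    (Φ : (Fin m → ℝ) × E → E) : Prop where
  isOpen : IsOpen W
  contDiffOn : ContDiffOn ℝ ∞ Φ W
  maps : ∀ z ∈ W, Φ z ∈ O
  zero : ∀ q, (0, q) ∈ W → Φ (0, q) = q
  single : ∀ z ∈ W, ∀ i, fderiv ℝ Φ z (Pi.single i 1, 0) = Z i (Φ z)

namespace IsFlow

variable {Z : Fin m → E → E} {O : Set E} {W : Set ((Fin m → ℝ) × E)} {Φ : (Fin m → ℝ) × E → E}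

theorem contDiffAt (h : IsFlow Z O W Φ) {z} (hz : z ∈ W) : ContDiffAt ℝ ∞ Φ z :=
  h.contDiffOn.contDiffAt (h.isOpen.mem_nhds hz)

theorem hasFDerivAt (h : IsFlow Z O W Φ) {z} (hz : z ∈ W) : HasFDerivAt Φ (fderiv ℝ Φ z) z :=
  ((h.contDiffAt hz).differentiableAt (by simp)).hasFDerivAt

theorem fderiv_left (h : IsFlow Z O W Φ) {z} (hz : z ∈ W) (σ : Fin m → ℝ) :
    fderiv ℝ Φ z (σ, 0) = ∑ i, σ i • Z i (Φ z) := by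
  have : ((σ, 0) : (Fin m → ℝ) × E) = ∑ i, σ i • (Pi.single i 1, 0) := by
    refine Prod.ext ?_ ?_
    · simp only [Prod.fst_sum, Prod.smul_fst]
      ext j
      simp [Pi.single_apply]
    · simp [Prod.snd_sum]
  rw [this, map_sum]
  exact Finset.sum_congr rfl fun i _ => by rw [map_smul, h.single z hz i]

theorem fderiv_zero (h : IsFlow Z O W Φ) {q : E} (hq : (0, q) ∈ W) (σ : Fin m → ℝ) (ρ : E) :
    fderiv ℝ Φ (0, q) (σ, ρ) = ∑ i, σ i • Z i q + ρ := by
  have h1 : ((σ, ρ) : (Fin m → ℝ) × E) = (σ, 0) + (0, ρ) := by simp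
  rw [h1, map_add, h.fderiv_left hq, h.zero q hq]
  congr 1
  have h2 : HasFDerivAt (fun x : E => Φ ((0 : Fin m → ℝ), x))
      ((fderiv ℝ Φ (0, q)).comp (.inr ℝ _ _)) q :=
    (h.hasFDerivAt hq).comp q (hasFDerivAt_prodMk_right _ _)
  have h3 : HasFDerivAt (fun x : E => Φ ((0 : Fin m → ℝ), x)) (.id ℝ E) q := by
    refine (hasFDerivAt_id q).congr_of_eventuallyEq ?_
    have : IsOpen {x : E | ((0 : Fin m → ℝ), x) ∈ W} := h.isOpen.preimage (by fun_prop)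
    filter_upwards [this.mem_nhds hq] with x hx
    exact h.zero x hx
  exact DFunLike.congr_fun (h2.unique h3) ρ

theorem hasDerivAt_ray (h : IsFlow Z O W Φ) {s : Fin m → ℝ} {q : E} {τ : ℝ}
    (hτ : (τ • s, q) ∈ W) :
    HasDerivAt (fun τ : ℝ => Φ (τ • s, q)) (∑ i, s i • Z i (Φ (τ • s, q))) τ := by
  have h1 : HasDerivAt (fun τ : ℝ => (τ • s, q)) (s, 0) τ := by
    have := (hasDerivAt_id τ).smul_const s
    rw [one_smul] at this
    exact this.prodMk (hasDerivAt_const τ q)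
  have := (h.hasFDerivAt hτ).comp_hasDerivAt τ h1
  rwa [h.fderiv_left hτ] at this

/-- If the components of the `Z_i` along the image of the projection `P` are functions of `P x`,
then the flow is projectable. -/
theorem projection_eq (h : IsFlow Z O W Φ) {p : E} {P : E →L[ℝ] E} (hPP : ∀ x, P (P x) = P x)
    (hPZ : ∀ i, ∀ x ∈ O, ∀ y ∈ O, P x = P y → P (Z i x) = P (Z i y)) {N : Set E} {K : NNReal}
    {T : Set E} (hN : ∀ x ∈ N, x ∈ O ∧ p + P (x - p) ∈ O ∧ P x ∈ T)
    (hK : LipschitzOnWith K (fun a i => P (Z i (p + (a - P p)))) T) {s : Fin m → ℝ} {q q' : E}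
    (hq : ∀ τ ∈ Icc (0 : ℝ) 1, (τ • s, q) ∈ W ∧ Φ (τ • s, q) ∈ N)
    (hq' : ∀ τ ∈ Icc (0 : ℝ) 1, (τ • s, q') ∈ W ∧ Φ (τ • s, q') ∈ N) (hqq' : P q = P q') :
    P (Φ (s, q)) = P (Φ (s, q')) := by
  let L : (Fin m → E) →L[ℝ] E := ∑ i, s i • ContinuousLinearMap.proj (R := ℝ) (φ := fun _ => E) i
  -- The field induced on the image of `P`, evaluated at the lift `p + (a - P p)` of `a`.
  -- Projectability makes the choice of lift immaterial, so both projected curves solve `a' = v(a)`.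
  let v : E → E := fun a => L (fun i => P (Z i (p + (a - P p))))
  have hv : LipschitzOnWith (‖L‖₊ * K) v T := L.lipschitz.comp_lipschitzOnWith hK
  have hd : ∀ q, (∀ τ ∈ Icc (0 : ℝ) 1, (τ • s, q) ∈ W ∧ Φ (τ • s, q) ∈ N) → ∀ τ ∈ Icc (0 : ℝ) 1,
      HasDerivAt (fun τ : ℝ => P (Φ (τ • s, q))) (v (P (Φ (τ • s, q)))) τ := by
    intro q hq τ hτ
    obtain ⟨hW, hmem⟩ := hq τ hτ
    obtain ⟨hO, hO', -⟩ := hN _ hmem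
    have := P.hasFDerivAt.comp_hasDerivAt τ (h.hasDerivAt_ray hW)
    refine this.congr_deriv ?_
    simp only [v, L, map_sum, map_smul, sum_apply, smul_apply, ContinuousLinearMap.proj_apply]
    refine Finset.sum_congr rfl fun i _ => ?_
    rw [← map_sub, hPZ i _ hO _ hO' (by rw [map_add, hPP, map_sub, add_sub_cancel])]
  have key := ODE_solution_unique_of_mem_Icc_right (v := fun _ => v) (s := fun _ => T)
    (f := fun τ : ℝ => P (Φ (τ • s, q))) (g := fun τ : ℝ => P (Φ (τ • s, q'))) (a := 0) (b := 1)
    (fun _ _ => hv)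
    (fun τ hτ => (hd q hq τ hτ).continuousAt.continuousWithinAt)
    (fun τ hτ => (hd q hq τ (Ico_subset_Icc_self hτ)).hasDerivWithinAt)
    (fun τ hτ => (hN _ (hq τ (Ico_subset_Icc_self hτ)).2).2.2)
    (fun τ hτ => (hd q' hq' τ hτ).continuousAt.continuousWithinAt)
    (fun τ hτ => (hd q' hq' τ (Ico_subset_Icc_self hτ)).hasDerivWithinAt)
    (fun τ hτ => (hN _ (hq' τ (Ico_subset_Icc_self hτ)).2).2.2) (by
      have h0 := (hq 0 ⟨le_rfl, zero_le_one⟩).1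
      have h0' := (hq' 0 ⟨le_rfl, zero_le_one⟩).1
      rw [zero_smul] at h0 h0'
      simp only [zero_smul, h.zero _ h0, h.zero _ h0', hqq'])
  simpa using key (right_mem_Icc.2 zero_le_one)

end IsFlow

end Straightening

/-! ### Straightening coordinates built from the joint flow. -/

section Straightening

variable {E F : Type*} [NormedAddCommGroup E] [NormedSpace ℝ E] [NormedAddCommGroup F]
  [NormedSpace ℝ F] {m : ℕ}

/-- Near a point where the projections of the `Z_i` are linearly independent, the parameters `s` and
the projection of the initial point `w` are determined by the projection of `Φ(s, w)`. -/
theorem IsFlow.exists_injOn [FiniteDimensional ℝ E] {Z : Fin m → E → E} {O : Set E}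
    {W : Set ((Fin m → ℝ) × E)} {Φ : (Fin m → ℝ) × E → E} (h : IsFlow Z O W Φ) {p : E}
    (hp : (0, p) ∈ W) {P : E →L[ℝ] E} {l : E →L[ℝ] Fin m → ℝ}
    (hlZ : ∀ i, l (Z i p) = Pi.single i 1) (hlP : ∀ x, l (P x) = l x) :
    ∃ V : Set ((Fin m → ℝ) × E), IsOpen V ∧ (0, p) ∈ V ∧
      InjOn (fun x => (l (x.2 - p), P (Φ x) + (x.2 - p) - P (x.2 - p))) V := by
  let D : (Fin m → ℝ) × E →L[ℝ] (Fin m → ℝ) × E :=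
    (l.comp (.snd ℝ _ _)).prod
      (P.comp (fderiv ℝ Φ (0, p)) + .snd ℝ _ _ - P.comp (.snd ℝ _ _))
  have hD : ∀ σ ρ, D (σ, ρ) = (l ρ, P (∑ i, σ i • Z i p) + ρ) := by
    intro σ ρ
    simp only [D, ContinuousLinearMap.prod_apply, sub_apply, add_apply,
      ContinuousLinearMap.comp_apply, ContinuousLinearMap.coe_snd', h.fderiv_zero hp, map_add]
    congr 1
    abel
  have hlσ : ∀ σ : Fin m → ℝ, l (P (∑ i, σ i • Z i p)) = σ := by
    intro σ
    rw [hlP, map_sum]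
    ext j
    simp [hlZ, Pi.single_apply]
  -- If `D(σ, ρ) = 0`, applying `l` to the second component gives `σ + l ρ = 0`; as `l ρ = 0`, first
  -- `σ` and then `ρ` vanishes.
  have hinj : Function.Injective D.toLinearMap := by
    rw [← LinearMap.ker_eq_bot, LinearMap.ker_eq_bot']
    rintro ⟨σ, ρ⟩ h0
    have h1 : D (σ, ρ) = 0 := h0
    rw [hD, Prod.mk_eq_zero] at h1
    have h2 := congrArg l h1.2
    rw [map_add, hlσ, h1.1, add_zero, map_zero] at h2
    have h3 := h1.2
    simp only [h2, Pi.zero_apply, zero_smul, Finset.sum_const_zero, map_zero, zero_add] at h3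
    rw [h2, h3, Prod.mk_zero_zero]
  let e := (LinearEquiv.ofInjectiveEndo D.toLinearMap hinj).toContinuousLinearEquiv
  have hsmooth : ContDiffOn ℝ ∞
      (fun x : (Fin m → ℝ) × E => (l (x.2 - p), P (Φ x) + (x.2 - p) - P (x.2 - p))) W := by
    have h2 : ContDiffOn ℝ ∞ (fun x : (Fin m → ℝ) × E => x.2 - p) W :=
      (contDiff_snd.sub contDiff_const).contDiffOn
    exact (l.contDiff.comp_contDiffOn h2).prodMk
      (((P.contDiff.comp_contDiffOn h.contDiffOn).add h2).sub (P.contDiff.comp_contDiffOn h2))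
  have hder : HasFDerivAt
      (fun x : (Fin m → ℝ) × E => (l (x.2 - p), P (Φ x) + (x.2 - p) - P (x.2 - p)))
      (e : (Fin m → ℝ) × E →L[ℝ] (Fin m → ℝ) × E) (0, p) := by
    have h2 : HasFDerivAt (fun x : (Fin m → ℝ) × E => x.2 - p) (.snd ℝ _ _) (0, p) :=
      hasFDerivAt_snd.sub_const p
    have : (e : (Fin m → ℝ) × E →L[ℝ] (Fin m → ℝ) × E) = D := by
      exact ContinuousLinearMap.ext fun x => rfl
    rw [this]
    exact (l.hasFDerivAt.comp _ h2).prodMk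
      (((P.hasFDerivAt.comp _ (h.hasFDerivAt hp)).add h2).sub (P.hasFDerivAt.comp _ h2))
  obtain ⟨H, hH, hmem, -, -⟩ := exists_openPartialHomeomorph_contDiffOn h.isOpen hp hsmooth e hder
  exact ⟨H.source, H.open_source, hmem, hH ▸ H.injOn⟩

/-- Simultaneous normal form `Z_i = ∂_{s^i}` of commuting vector fields in coordinates `(s, y)`. If
the `Z_i` are projectable along `P`, then the functions `s` and `θ(y)` are functions of `P x`. -/
theorem exists_straightening [FiniteDimensional ℝ E] {Z : Fin m → E → E} {O : Set E}
    (hO : IsOpen O) {p : E} (hp : p ∈ O) (hZ : ∀ i, ContDiffOn ℝ ∞ (Z i) O)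
    (hcomm : ∀ i j, ∀ x ∈ O, fderiv ℝ (Z i) x (Z j x) = fderiv ℝ (Z j) x (Z i x))
    {P : E →L[ℝ] E} (hPP : ∀ x, P (P x) = P x)
    (hPZ : ∀ i, ∀ x ∈ O, ∀ y ∈ O, P x = P y → P (Z i x) = P (Z i y))
    (Λ : E ≃L[ℝ] (Fin m → ℝ) × F) (hΛZ : ∀ i, Λ (Z i p) = (Pi.single i 1, 0))
    (hΛP : ∀ x, (Λ (P x)).1 = (Λ x).1) (θ : F →L[ℝ] ℝ) (hθ : ∀ x, θ (Λ (P x)).2 = θ (Λ x).2)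
    {A : E → E} (hA : ContinuousOn A O) (hAp : θ (Λ (A p)).2 ≠ 0) :
    ∃ (e : OpenPartialHomeomorph E ((Fin m → ℝ) × F)) (r : ℝ), 0 < r ∧ p ∈ e.source ∧ e p = 0 ∧
      e.source ⊆ O ∧ e.target = Metric.ball 0 r ∧ ContDiffOn ℝ ∞ e e.source ∧
      ContDiffOn ℝ ∞ e.symm e.target ∧
      (∀ x ∈ e.source, ∀ i, fderiv ℝ e x (Z i x) = (Pi.single i 1, 0)) ∧
      (∀ x ∈ e.source, ∀ y ∈ e.source, P x = P y → (e x).1 = (e y).1 ∧ θ (e x).2 = θ (e y).2) ∧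
      ∀ x ∈ e.source, θ (fderiv ℝ e x (A x)).2 ≠ 0 := by
  obtain ⟨Φ, W, hW, hpW, hΦ, hΦO, hΦ0, hΦZ⟩ := exists_flow hO hp hZ hcomm
  have hflow : IsFlow Z O W Φ := ⟨hW, hΦ, hΦO, hΦ0, hΦZ⟩
  obtain ⟨V, hV, hpV, hinj⟩ := hflow.exists_injOn hpW (P := P)
    (l := (ContinuousLinearMap.fst ℝ _ _).comp (Λ : E →L[ℝ] (Fin m → ℝ) × F))
    (fun i => congrArg Prod.fst (hΛZ i)) hΛP
  -- the coordinates on the slice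
  let ρ : F →L[ℝ] E := (Λ.symm : (Fin m → ℝ) × F →L[ℝ] E).comp (.inr ℝ _ _)
  have hρ : ∀ y, Λ (ρ y) = (0, y) := fun y => Λ.apply_symm_apply _
  -- The flow starts from the affine slice `p + ρ y`. The variant `c'` starts from `p + P (ρ y)`,
  -- which has the same projection, and serves to compare points with equal `P x`.
  let c : (Fin m → ℝ) × F → (Fin m → ℝ) × E := fun z => (z.1, p + ρ z.2)
  let c' : (Fin m → ℝ) × F → (Fin m → ℝ) × E := fun z => (z.1, p + P (ρ z.2))
  have hc0 : c 0 = (0, p) := by simp [c]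
  have hc0' : c' 0 = (0, p) := by simp [c']
  have hc : ContDiff ℝ ∞ c :=
    contDiff_fst.prodMk (contDiff_const.add (ρ.contDiff.comp contDiff_snd))
  have hc' : ContDiff ℝ ∞ c' :=
    contDiff_fst.prodMk (contDiff_const.add ((P.comp ρ).contDiff.comp contDiff_snd))
  have hcd : ∀ z, HasFDerivAt c ((ContinuousLinearMap.fst ℝ _ _).prod (ρ.comp (.snd ℝ _ _))) z :=
    fun z => hasFDerivAt_fst.prodMk
      ((ρ.hasFDerivAt.comp z hasFDerivAt_snd).const_add p)
  let Ψ : (Fin m → ℝ) × F → E := Φ ∘ c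
  have hWc : IsOpen (c ⁻¹' W) := hW.preimage hc.continuous
  have h0W : (0 : (Fin m → ℝ) × F) ∈ c ⁻¹' W := by rwa [mem_preimage, hc0]
  have hΨ : ContDiffOn ℝ ∞ Ψ (c ⁻¹' W) := hΦ.comp hc.contDiffOn fun z hz => hz
  have hΨd : ∀ z ∈ c ⁻¹' W, HasFDerivAt Ψ ((fderiv ℝ Φ (c z)).comp
      ((ContinuousLinearMap.fst ℝ _ _).prod (ρ.comp (.snd ℝ _ _)))) z := fun z hz =>
    (hflow.hasFDerivAt hz).comp z (hcd z)
  have hΛs : ∀ s : Fin m → ℝ, Λ.symm (s, 0) = ∑ i, s i • Z i p := by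
    intro s
    rw [ContinuousLinearEquiv.symm_apply_eq, map_sum]
    refine Prod.ext ?_ ?_
    · rw [Prod.fst_sum]
      ext j
      simp [hΛZ, Pi.single_apply]
    · simp [Prod.snd_sum, hΛZ]
  have hΨ0 : HasFDerivAt Ψ (Λ.symm : (Fin m → ℝ) × F →L[ℝ] E) 0 := by
    refine (hΨd 0 h0W).congr_fderiv ?_
    refine ContinuousLinearMap.ext fun ⟨s, y⟩ => ?_
    rw [ContinuousLinearMap.comp_apply, hc0]
    refine (hflow.fderiv_zero hpW s (ρ y)).trans ?_
    rw [← hΛs]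
    show Λ.symm (s, 0) + Λ.symm (0, y) = Λ.symm (s, y)
    rw [← map_add]
    simp
  have : CompleteSpace F := by
    have : FiniteDimensional ℝ ((Fin m → ℝ) × F) := Λ.toLinearEquiv.finiteDimensional
    have : FiniteDimensional ℝ F := Module.Finite.of_surjective (LinearMap.snd ℝ (Fin m → ℝ) F)
      LinearMap.snd_surjective
    exact FiniteDimensional.complete ℝ F
  obtain ⟨h, hcoe, h0h, hhW, hsymm⟩ := exists_openPartialHomeomorph_contDiffOn hWc h0W hΨ Λ.symm hΨ0
  have hh0 : h 0 = p := by
    rw [hcoe]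
    show Φ (c 0) = p
    rw [hc0, hΦ0 p hpW]
  have hpt : p ∈ h.target := hh0 ▸ h.map_source h0h
  have hsymmp : h.symm p = 0 := by rw [← hh0, h.left_inv h0h]
  -- a neighborhood on which the projected flow is unique
  obtain ⟨K, T, hT, hK⟩ : ∃ K, ∃ T ∈ nhds (P p),
      LipschitzOnWith K (fun a i => P (Z i (p + (a - P p)))) T := by
    have : ContDiffAt ℝ 1 (fun a i => P (Z i (p + (a - P p)))) (P p) := by
      refine contDiffAt_pi.2 fun i => ?_
      refine P.contDiff.contDiffAt.comp _ (ContDiffAt.comp _ (n := 1) ?_ ?_)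
      · have := (hZ i).contDiffAt (hO.mem_nhds hp)
        simp only [sub_self, add_zero]
        exact this.of_le (by simp)
      · exact contDiffAt_const.add (contDiffAt_id.sub contDiffAt_const)
    exact this.exists_lipschitzOnWith
  have hTp : ∀ᶠ x in nhds p, P x ∈ T := P.continuous.continuousAt.eventually hT
  have hOp' : ∀ᶠ x in nhds p, p + P (x - p) ∈ O := by
    have hcont : Continuous fun x => p + P (x - p) := by fun_prop
    exact hcont.continuousAt.eventually (by
      simp only [sub_self, map_zero, add_zero]
      exact hO.mem_nhds hp)
  obtain ⟨N, hN, hNo, hpN⟩ := eventually_nhds_iff.1 ((hO.eventually_mem hp).and (hOp'.and hTp))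
  have hW1 : IsOpen (W ∩ Φ ⁻¹' N) := hΦ.continuousOn.isOpen_inter_preimage hW hNo
  have hpW1 : (0, p) ∈ W ∩ Φ ⁻¹' N := ⟨hpW, by rwa [mem_preimage, hΦ0 p hpW]⟩
  -- the set on which `A(t) ≠ 0`
  have hAev : ∀ᶠ z in nhds (0 : (Fin m → ℝ) × F), θ (fderiv ℝ h.symm (h z) (A (h z))).2 ≠ 0 := by
    have hd : fderiv ℝ h.symm p = (Λ : E →L[ℝ] (Fin m → ℝ) × F) := by
      refine (h.hasFDerivAt_symm (f' := Λ.symm) hpt ?_).fderiv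
      rw [hsymmp, hcoe]
      exact hΨ0
    have hcont : ContinuousAt (fun z => θ (fderiv ℝ h.symm (h z) (A (h z))).2) 0 := by
      have h1 : ContinuousAt h 0 := h.continuousAt h0h
      have h2 : ContinuousAt (fderiv ℝ h.symm) (h 0) := by
        rw [hh0]
        exact (hsymm.continuousOn_fderiv_of_isOpen h.open_target (by simp)).continuousAt
          (h.open_target.mem_nhds hpt)
      have h3 : ContinuousAt A (h 0) := by
        rw [hh0]
        exact hA.continuousAt (hO.mem_nhds hp)
      have h4 := (ContinuousAt.comp (f := h) h2 h1).clm_apply (ContinuousAt.comp (f := h) h3 h1)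
      exact θ.continuous.continuousAt.comp (continuous_snd.continuousAt.comp h4)
    refine hcont.eventually_ne ?_
    rw [hh0, hd]
    exact hAp
  -- One ball on which all the local conditions hold. With the maximum norm it contains `(τ s, y)`
  -- for `τ ∈ [0, 1]` along with `(s, y)`, so whole flow lines can be followed.
  obtain ⟨r, hr, hball⟩ : ∃ r > 0, ∀ z ∈ Metric.ball (0 : (Fin m → ℝ) × F) r, z ∈ h.source ∧
      c z ∈ W ∩ Φ ⁻¹' N ∧ c' z ∈ W ∩ Φ ⁻¹' N ∧ c' z ∈ V ∧
      θ (fderiv ℝ h.symm (h z) (A (h z))).2 ≠ 0 := by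
    have e1 : ∀ᶠ z in nhds 0, z ∈ h.source := h.open_source.eventually_mem h0h
    have e2 : ∀ᶠ z in nhds 0, c z ∈ W ∩ Φ ⁻¹' N :=
      hc.continuous.continuousAt.eventually (by rw [hc0]; exact hW1.mem_nhds hpW1)
    have e3 : ∀ᶠ z in nhds 0, c' z ∈ W ∩ Φ ⁻¹' N :=
      hc'.continuous.continuousAt.eventually (by rw [hc0']; exact hW1.mem_nhds hpW1)
    have e4 : ∀ᶠ z in nhds 0, c' z ∈ V :=
      hc'.continuous.continuousAt.eventually (by rw [hc0']; exact hV.mem_nhds hpV)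
    exact Metric.eventually_nhds_iff_ball.1 (e1.and (e2.and (e3.and (e4.and hAev))))
  let h' := h.restrOpen (Metric.ball 0 r) Metric.isOpen_ball
  have hs : h'.source = Metric.ball 0 r := by
    show h.source ∩ Metric.ball 0 r = _
    exact inter_eq_right.2 fun z hz => (hball z hz).1
  have ht : h'.target ⊆ h.target := fun x hx => by
    rw [← h'.right_inv hx]
    exact h.map_source (hball _ (hs ▸ h'.map_target hx)).1
  have h0s : (0 : (Fin m → ℝ) × F) ∈ h'.source := by
    rw [hs]
    exact Metric.mem_ball_self hr
  have hΨP : ∀ z ∈ Metric.ball (0 : (Fin m → ℝ) × F) r, P (Φ (c z)) = P (Φ (c' z)) := by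
    intro z hz
    have hτ : ∀ τ ∈ Icc (0 : ℝ) 1, (τ • z.1, z.2) ∈ Metric.ball (0 : (Fin m → ℝ) × F) r := by
      intro τ hτ
      rw [mem_ball_zero_iff] at hz ⊢
      refine lt_of_le_of_lt (max_le_max ?_ le_rfl) hz
      rw [norm_smul, Real.norm_of_nonneg hτ.1]
      exact mul_le_of_le_one_left (norm_nonneg _) hτ.2
    refine hflow.projection_eq (p := p) hPP hPZ hN hK (fun τ h => (hball _ (hτ τ h)).2.1)
      (fun τ h => (hball _ (hτ τ h)).2.2.1) ?_
    rw [map_add, map_add, hPP]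
  refine ⟨h'.symm, r, hr, ?_, hsymmp, ?_, hs, hsymm.mono ht, ?_, ?_, ?_, ?_⟩
  · have := h'.map_source h0s
    rwa [show h' 0 = p from hh0] at this
  · intro x hx
    have hz := h'.map_target hx
    rw [hs] at hz
    rw [← h'.right_inv hx, show h' (h'.symm x) = Φ (c (h'.symm x)) from congrFun hcoe _]
    exact hΦO _ (hball _ hz).2.1.1
  · show ContDiffOn ℝ ∞ h h'.source
    rw [hcoe, hs]
    exact hΨ.mono fun z hz => (hball z hz).2.1.1
  · intro x hx i
    have hz := h'.map_target hx
    rw [hs] at hz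
    have hzW := (hball _ hz).2.1.1
    set z := h'.symm x with hzdef
    have hx' : x = Ψ z := by
      rw [← h'.right_inv hx, ← hzdef]
      exact congrFun hcoe _
    have hd1 := hΨd z hzW
    have hd2 : HasFDerivAt h.symm (fderiv ℝ h.symm x) (Ψ z) := by
      rw [← hx']
      exact ((hsymm.contDiffAt (h.open_target.mem_nhds (ht hx))).differentiableAt
        (by simp)).hasFDerivAt
    have hd3 : HasFDerivAt (h.symm ∘ Ψ) (.id ℝ _) z := by
      refine (hasFDerivAt_id z).congr_of_eventuallyEq ?_
      filter_upwards [h.open_source.mem_nhds (hball _ hz).1] with w hw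
      rw [← hcoe]
      exact h.left_inv hw
    have h4 := DFunLike.congr_fun ((hd2.comp z hd1).unique hd3) (Pi.single i 1, 0)
    have h5 : (fderiv ℝ Φ (c z)) (Pi.single i 1, 0) = Z i x := by
      rw [hΦZ _ hzW i, hx']
      rfl
    show fderiv ℝ h.symm x (Z i x) = _
    rw [← h5]
    refine Eq.trans ?_ h4
    simp
  · intro x hx y hy hxy
    have hzx := h'.map_target hx
    have hzy := h'.map_target hy
    rw [hs] at hzx hzy
    have hxΨ : x = Φ (c (h'.symm x)) := by
      nth_rw 1 [← h'.right_inv hx]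
      exact congrFun hcoe _
    have hyΨ : y = Φ (c (h'.symm y)) := by
      nth_rw 1 [← h'.right_inv hy]
      exact congrFun hcoe _
    rw [hxΨ, hyΨ, hΨP _ hzx, hΨP _ hzy] at hxy
    have hl : ∀ z, (Λ (P (ρ z))).1 = 0 := fun z => by rw [hΛP, hρ]
    -- At points of the form `c'` the first component of the injective map is zero and the second is
    -- `P Φ`, so equal projections force equal `s` and equal `P (ρ y)`.
    have := hinj (hball _ hzx).2.2.2.1 (hball _ hzy).2.2.2.1 (by
      simp only [c'] at hxy ⊢
      simp [hxy, hl, hPP])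
    refine ⟨congrArg (fun z => z.1) this, ?_⟩
    have h6 : P (ρ (h'.symm x).2) = P (ρ (h'.symm y).2) := add_left_cancel (congrArg Prod.snd this)
    have h7 : ∀ y, θ (Λ (P (ρ y))).2 = θ y := fun y => by rw [hθ, hρ]
    rw [← h7, h6, h7]
  · intro x hx
    have hz := h'.map_target hx
    rw [hs] at hz
    have := (hball _ hz).2.2.2.2
    rwa [show h (h'.symm x) = x from h'.right_inv hx] at this

end Straightening

/-! ### Reduction in the new coordinates -/

section Reduction

variable {E F H : Type*} [NormedAddCommGroup E] [NormedSpace ℝ E] [NormedAddCommGroup F]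
  [NormedSpace ℝ F] [NormedAddCommGroup H] [NormedSpace ℝ H] {m : ℕ}

/-- A function on a ball with vanishing partial derivatives in the directions `s^i`. -/
theorem eq_zero_left_of_fderiv_eq_zero {g : (Fin m → ℝ) × F → H} {r : ℝ}
    (hg : DifferentiableOn ℝ g (Metric.ball 0 r))
    (h : ∀ z ∈ Metric.ball (0 : (Fin m → ℝ) × F) r, ∀ i, fderiv ℝ g z (Pi.single i 1, 0) = 0)
    {z : (Fin m → ℝ) × F} (hz : z ∈ Metric.ball (0 : (Fin m → ℝ) × F) r) : g z = g (0, z.2) := by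
  obtain ⟨s, y⟩ := z
  have hτ : ∀ τ ∈ Icc (0 : ℝ) 1, (τ • s, y) ∈ Metric.ball (0 : (Fin m → ℝ) × F) r := by
    intro τ hτ
    rw [mem_ball_zero_iff] at hz ⊢
    refine lt_of_le_of_lt (max_le_max ?_ le_rfl) hz
    rw [norm_smul, Real.norm_of_nonneg hτ.1]
    exact mul_le_of_le_one_left (norm_nonneg _) hτ.2
  have hs : ∀ w ∈ Metric.ball (0 : (Fin m → ℝ) × F) r, fderiv ℝ g w (s, 0) = 0 := by
    intro w hw
    have : ((s, 0) : (Fin m → ℝ) × F) = ∑ i, s i • (Pi.single i 1, 0) := by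
      refine Prod.ext ?_ ?_
      · simp only [Prod.fst_sum, Prod.smul_fst]
        ext j
        simp [Pi.single_apply]
      · simp [Prod.snd_sum]
    rw [this, map_sum]
    exact Finset.sum_eq_zero fun i _ => by rw [map_smul, h w hw i, smul_zero]
  have hd : ∀ τ ∈ Icc (0 : ℝ) 1, HasDerivAt (fun τ : ℝ => g (τ • s, y)) 0 τ := by
    intro τ hτ'
    have h1 : HasDerivAt (fun τ : ℝ => (τ • s, y)) (s, 0) τ := by
      have := (hasDerivAt_id τ).smul_const s
      rw [one_smul] at this
      exact this.prodMk (hasDerivAt_const τ y)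
    have h2 := ((hg _ (hτ τ hτ')).differentiableAt
      (Metric.isOpen_ball.mem_nhds (hτ τ hτ'))).hasFDerivAt.comp_hasDerivAt τ h1
    rwa [hs _ (hτ τ hτ')] at h2
  have := constant_of_has_deriv_right_zero (a := 0) (b := 1) (f := fun τ : ℝ => g (τ • s, y))
    (fun τ h => (hd τ h).continuousAt.continuousWithinAt)
    (fun τ h => (hd τ (Ico_subset_Icc_self h)).hasDerivWithinAt) 1 ⟨zero_le_one, le_rfl⟩
  simpa using this

/-- The components of the field `X` in the coordinates `e`. -/
noncomputable def coordField {G : Type*} [NormedAddCommGroup G] [NormedSpace ℝ G]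
    (e : OpenPartialHomeomorph E G) (X : E → E) (z : G) : G :=
  fderiv ℝ e (e.symm z) (X (e.symm z))

theorem contDiffOn_coordField {G : Type*} [NormedAddCommGroup G] [NormedSpace ℝ G]
    {e : OpenPartialHomeomorph E G} (he : ContDiffOn ℝ ∞ e e.source)
    (hes : ContDiffOn ℝ ∞ e.symm e.target) {X : E → E} (hX : ContDiffOn ℝ ∞ X e.source) :
    ContDiffOn ℝ ∞ (coordField e X) e.target :=
  ((he.fderiv_of_isOpen e.open_source (by simp)).clm_apply hX).comp hes e.symm.mapsTo

/-- Coordinates `e = (s, y)` on a ball in which `Z_i = ∂_{s^i}`. -/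
structure IsNormalForm (e : OpenPartialHomeomorph E ((Fin m → ℝ) × F)) (r : ℝ)
    (Z : Fin m → E → E) : Prop where
  target : e.target = Metric.ball 0 r
  smooth : ContDiffOn ℝ ∞ e e.source
  smooth_symm : ContDiffOn ℝ ∞ e.symm e.target
  fields : ∀ x ∈ e.source, ∀ i, fderiv ℝ e x (Z i x) = (Pi.single i 1, 0)
  diff : ∀ x ∈ e.source, ∀ i, DifferentiableAt ℝ (Z i) x

namespace IsNormalForm

variable {e : OpenPartialHomeomorph E ((Fin m → ℝ) × F)} {r : ℝ} {Z : Fin m → E → E}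

/-- In these coordinates `Z_i` is a constant field, and the bracket with a constant field is a
directional derivative. Brackets thus control the dependence on `s`. -/
theorem fderiv_coordField (h : IsNormalForm e r Z) {X : E → E} (hX : ContDiffOn ℝ ∞ X e.source)
    (i : Fin m) {z : (Fin m → ℝ) × F} (hz : z ∈ e.target) :
    fderiv ℝ (coordField e X) z (Pi.single i 1, 0)
      = fderiv ℝ e (e.symm z) (lieBracket ℝ (Z i) X (e.symm z)) := by
  have hx := e.map_target hz
  have hn := e.open_source.mem_nhds hx
  have hXc := contDiffOn_coordField h.smooth h.smooth_symm hX
  rw [fderiv_lieBracket_of_related (X₁ := Z i) (X₂ := X) (Y₁ := fun _ => (Pi.single i 1, 0))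
    (Y₂ := coordField e X) (h.smooth.contDiffAt hn)
    (h.diff _ hx i) ((hX.contDiffAt hn).differentiableAt (by simp))
    (differentiableAt_const _) (by
      rw [e.right_inv hz]
      exact (hXc.contDiffAt (e.open_target.mem_nhds hz)).differentiableAt (by simp))
    (Filter.eventually_of_mem hn fun x hx => h.fields x hx i)
    (Filter.eventually_of_mem hn fun x hx => by rw [coordField, e.left_inv hx]),
    lieBracket_eq, e.right_inv hz]
  simp

variable (e r) in
/-- The smooth field on the space of the `y` with the values of `g` at `s = 0`. -/
theorem exists_vf {V : Opens F} (hV : (V : Set F) = Metric.ball 0 r) {g : (Fin m → ℝ) × F → F}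
    (hg : ContDiffOn ℝ ∞ g (Metric.ball 0 r)) : ∃ Y : VF V, ∀ y ∈ V, Y.1 y = g (0, y) := by
  classical
  have hmaps : MapsTo (fun y : F => ((0 : Fin m → ℝ), y)) V (Metric.ball 0 r) := by
    intro y hy
    rw [hV, mem_ball_zero_iff] at hy
    rw [mem_ball_zero_iff, Prod.norm_mk, norm_zero, max_eq_right (norm_nonneg y)]
    exact hy
  exact ⟨⟨fun y => if y ∈ V then g (0, y) else 0,
    (hg.comp (contDiff_const.prodMk contDiff_id).contDiffOn hmaps).congr fun y hy => if_pos hy,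
    fun y hy => if_neg hy⟩, fun y hy => if_pos hy⟩

theorem snd_image (h : IsNormalForm e r Z) : Prod.snd '' e.target = Metric.ball (0 : F) r := by
  rw [h.target]
  ext y
  constructor
  · rintro ⟨z, hz, rfl⟩
    rw [mem_ball_zero_iff] at hz ⊢
    exact (norm_snd_le z).trans_lt hz
  · intro hy
    refine ⟨(0, y), ?_, rfl⟩
    rw [mem_ball_zero_iff] at hy
    rw [mem_ball_zero_iff, Prod.norm_mk, norm_zero, max_eq_right (norm_nonneg y)]
    exact hy

variable {U : Opens E} {V : Opens F}

/-- The reduced form of a field that satisfies the inheritance conditions. -/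
theorem exists_isReducedForm (h : IsNormalForm e r Z) (hU : e.source ⊆ U)
    (hV : (V : Set F) = Metric.ball 0 r) (X : VF U)
    (hX : ∀ x ∈ e.source, ∀ i, (fderiv ℝ e x (lieBracket ℝ (Z i) X.1 x)).2 = 0) :
    ∃ Y : VF V, IsReducedForm e X Y := by
  have hXs : ContDiffOn ℝ ∞ X.1 e.source := X.2.1.mono hU
  have hc := contDiffOn_coordField h.smooth h.smooth_symm hXs
  have hc2 : ContDiffOn ℝ ∞ (fun z => (coordField e X.1 z).2) (Metric.ball 0 r) :=
    h.target ▸ contDiff_snd.comp_contDiffOn hc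
  obtain ⟨Y, hY⟩ := exists_vf r hV hc2
  refine ⟨Y, fun x hx => ?_⟩
  have hz := e.map_source hx
  rw [hY _ (snd_mem_of_mem_source (hV.trans h.snd_image.symm) hx)]
  rw [h.target] at hz
  rw [← eq_zero_left_of_fderiv_eq_zero (hc2.differentiableOn (by simp)) ?_ hz, coordField,
    e.left_inv hx]
  intro z hz i
  rw [← h.target] at hz
  have hd := (hc.contDiffAt (e.open_target.mem_nhds hz)).differentiableAt (n := ∞) (by simp)
  rw [fderiv.snd hd]
  show (fderiv ℝ (coordField e X.1) z (Pi.single i 1, 0)).2 = 0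
  rw [h.fderiv_coordField hXs i hz]
  exact hX _ (e.map_target hz) i

theorem contDiffOn_time (h : IsNormalForm e r Z) {A : E → E} (hA : ContDiffOn ℝ ∞ A e.source)
    (θ : F →L[ℝ] ℝ) : ContDiffOn ℝ ∞ (fun x => θ (fderiv ℝ e x (A x)).2) e.source :=
  θ.contDiff.comp_contDiffOn (contDiff_snd.comp_contDiffOn
    ((h.smooth.fderiv_of_isOpen e.open_source (by simp)).clm_apply hA))

/-- The field `A / A(t)` commutes with `X` up to multiples of `A`, if `A` does. -/
theorem lieBracket_inv_time (h : IsNormalForm e r Z) {A X : E → E}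
    (hA : ContDiffOn ℝ ∞ A e.source) {θ : F →L[ℝ] ℝ}
    (hθ : ∀ x ∈ e.source, θ (fderiv ℝ e x (A x)).2 ≠ 0) {x : E} (hx : x ∈ e.source) {μ : ℝ}
    (hXA : lieBracket ℝ X A x = μ • A x) :
    ∃ ν : ℝ, lieBracket ℝ X (fun x => (θ (fderiv ℝ e x (A x)).2)⁻¹ • A x) x = ν • A x := by
  have hn := e.open_source.mem_nhds hx
  have hinv : DifferentiableAt ℝ (fun x => (θ (fderiv ℝ e x (A x)).2)⁻¹) x :=
    ((((h.contDiffOn_time hA θ).inv hθ).contDiffAt hn).differentiableAt (by simp))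
  have hAd : DifferentiableAt ℝ A x := (hA.contDiffAt hn).differentiableAt (by simp)
  have := lieBracket_smul_right (V := X) hinv hAd
  refine ⟨fderiv ℝ (fun x => (θ (fderiv ℝ e x (A x)).2)⁻¹) x (X x)
    + (θ (fderiv ℝ e x (A x)).2)⁻¹ * μ, ?_⟩
  rw [add_smul, mul_smul, ← hXA]
  exact this

/-- The operator `Â` of the reduced system. -/
theorem exists_operator (h : IsNormalForm e r Z) (hU : e.source ⊆ U)
    (hV : (V : Set F) = Metric.ball 0 r) (A : VF U)
    (hZA : ∀ x ∈ e.source, ∀ i, ∃ μ : ℝ, lieBracket ℝ (Z i) A.1 x = μ • A.1 x) {θ : F →L[ℝ] ℝ}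
    (hθ : ∀ x ∈ e.source, θ (fderiv ℝ e x (A.1 x)).2 ≠ 0) :
    ∃ (B : VF V) (u : F → Fin m → ℝ), (∀ y ∈ V, θ (B.1 y) = 1) ∧
      ∀ x ∈ e.source, fderiv ℝ e x (A.1 x)
        = θ (fderiv ℝ e x (A.1 x)).2 • (u (e x).2, B.1 (e x).2) := by
  have hAs : ContDiffOn ℝ ∞ A.1 e.source := A.2.1.mono hU
  let A₁ : E → E := fun x => (θ (fderiv ℝ e x (A.1 x)).2)⁻¹ • A.1 x
  have hA₁ : ContDiffOn ℝ ∞ A₁ e.source := ((h.contDiffOn_time hAs θ).inv hθ).smul hAs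
  have hc := contDiffOn_coordField h.smooth h.smooth_symm hA₁
  have hcθ : ∀ z ∈ e.target, θ (coordField e A₁ z).2 = 1 := by
    intro z hz
    simp only [coordField, A₁, map_smul, Prod.smul_snd, smul_eq_mul]
    exact inv_mul_cancel₀ (hθ _ (e.map_target hz))
  have hzero : ∀ z ∈ e.target, ∀ i, fderiv ℝ (coordField e A₁) z (Pi.single i 1, 0) = 0 := by
    intro z hz i
    have hd := (hc.contDiffAt (e.open_target.mem_nhds hz)).differentiableAt (n := ∞) (by simp)
    obtain ⟨μ, hμ⟩ := hZA _ (e.map_target hz) i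
    obtain ⟨ν, hν⟩ := h.lieBracket_inv_time hAs hθ (e.map_target hz) hμ
    have h1 : fderiv ℝ (coordField e A₁) z (Pi.single i 1, 0)
        = ν • fderiv ℝ e (e.symm z) (A.1 (e.symm z)) := by
      rw [h.fderiv_coordField hA₁ i hz, hν, map_smul]
    -- The `t`-component of `A / A(t)` is constantly `1`, so its `s`-derivative vanishes. That
    -- derivative is also `ν A(t)` with `A(t) ≠ 0`, whence `ν = 0` and no component depends on `s`.
    have h2 : θ (fderiv ℝ (coordField e A₁) z (Pi.single i 1, 0)).2 = 0 := by
      have h3 : HasFDerivAt (fun z => θ (coordField e A₁ z).2)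
          (θ.comp ((ContinuousLinearMap.snd ℝ _ _).comp (fderiv ℝ (coordField e A₁) z))) z :=
        θ.hasFDerivAt.comp z hd.hasFDerivAt.snd
      have h4 : HasFDerivAt (fun z => θ (coordField e A₁ z).2)
          (0 : (Fin m → ℝ) × F →L[ℝ] ℝ) z :=
        (hasFDerivAt_const (1 : ℝ) z).congr_of_eventuallyEq
          (Filter.eventually_of_mem (e.open_target.mem_nhds hz) hcθ)
      exact DFunLike.congr_fun (h3.unique h4) (Pi.single i 1, 0)
    rw [h1, Prod.smul_snd, map_smul, smul_eq_mul] at h2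
    rw [h1, (mul_eq_zero.1 h2).resolve_right (hθ _ (e.map_target hz)), zero_smul]
  rw [h.target] at hc hzero hcθ
  have hind := fun {z} => eq_zero_left_of_fderiv_eq_zero (z := z)
    (hc.differentiableOn (by simp)) hzero
  obtain ⟨B, hB⟩ := exists_vf r hV (contDiff_snd.comp_contDiffOn hc)
  refine ⟨B, fun y => (coordField e A₁ (0, y)).1, fun y hy => ?_, fun x hx => ?_⟩
  · rw [hB y hy]
    refine hcθ _ ?_
    rw [← SetLike.mem_coe, hV, mem_ball_zero_iff] at hy
    rw [mem_ball_zero_iff, Prod.norm_mk, norm_zero, max_eq_right (norm_nonneg y)]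
    exact hy
  · have hz := e.map_source hx
    rw [h.target] at hz
    rw [hB _ (snd_mem_of_mem_source (hV.trans h.snd_image.symm) hx)]
    have h5 : coordField e A₁ (e x)
        = (θ (fderiv ℝ e x (A.1 x)).2)⁻¹ • fderiv ℝ e x (A.1 x) := by
      simp only [coordField, A₁, map_smul, e.left_inv hx]
    show _ = _ • coordField e A₁ (0, (e x).2)
    rw [← hind hz, h5, smul_inv_smul₀ (hθ x hx)]

/-- The reduced forms of symmetries are symmetries of the reduced system. -/
theorem exists_lieBracket_eq (h : IsNormalForm e r Z) (hU : e.source ⊆ U)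
    (hV : (V : Set F) = Metric.ball 0 r) {A X : VF U} {B Y : VF V} {u : F → Fin m → ℝ}
    {θ : F →L[ℝ] ℝ} (hθ : ∀ x ∈ e.source, θ (fderiv ℝ e x (A.1 x)).2 ≠ 0)
    (hAB : ∀ x ∈ e.source, fderiv ℝ e x (A.1 x)
        = θ (fderiv ℝ e x (A.1 x)).2 • (u (e x).2, B.1 (e x).2))
    (hXY : IsReducedForm e X Y)
    (hXA : ∀ x ∈ e.source, ∃ μ : ℝ, lieBracket ℝ X.1 A.1 x = μ • A.1 x) {y : F} (hy : y ∈ V) :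
    ∃ μ : ℝ, lieBracket ℝ Y.1 B.1 y = μ • B.1 y := by
  have hVt : (V : Set F) = Prod.snd '' e.target := hV.trans h.snd_image.symm
  have hy' := hy
  rw [← SetLike.mem_coe, hVt] at hy'
  obtain ⟨z, hz, rfl⟩ := hy'
  have hx := e.map_target hz
  set x := e.symm z with hxz
  have hn := e.open_source.mem_nhds hx
  have hzx : z.2 = (e x).2 := by rw [hxz, e.right_inv hz]
  have hAs : ContDiffOn ℝ ∞ A.1 e.source := A.2.1.mono hU
  let A₁ : E → E := fun x => (θ (fderiv ℝ e x (A.1 x)).2)⁻¹ • A.1 x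
  have hA₁ : ContDiffOn ℝ ∞ A₁ e.source := ((h.contDiffOn_time hAs θ).inv hθ).smul hAs
  have hd : ∀ q ∈ e.source, ∀ v, fderiv ℝ (fun q => (e q).2) q v = (fderiv ℝ e q v).2 := by
    intro q hq v
    rw [fderiv.snd ((h.smooth.contDiffAt (e.open_source.mem_nhds hq)).differentiableAt (by simp))]
    rfl
  have hA2 : ∀ q ∈ e.source, (fderiv ℝ e q (A.1 q)).2
      = θ (fderiv ℝ e q (A.1 q)).2 • B.1 (e q).2 := fun q hq => congrArg Prod.snd (hAB q hq)
  obtain ⟨μ, hμ⟩ := hXA x hx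
  obtain ⟨ν, hν⟩ := h.lieBracket_inv_time hAs hθ hx hμ
  have hyV := snd_mem_of_mem_source hVt hx
  -- It is `A / A(t)`, rather than `A` with its factor possibly depending on `s`, that is related to
  -- `B`.
  have key := fderiv_lieBracket_of_related (f := fun q => (e q).2) (X₁ := X.1) (X₂ := A₁)
    (Y₁ := Y.1) (Y₂ := B.1) (h.smooth.contDiffAt hn).snd
    (differentiableAt_of_mem X (hU hx)) ((hA₁.contDiffAt hn).differentiableAt (by simp))
    (differentiableAt_of_mem Y hyV) (differentiableAt_of_mem B hyV)
    (Filter.eventually_of_mem hn fun q hq => (hd q hq _).trans (hXY q hq))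
    (Filter.eventually_of_mem hn fun q hq => by
      rw [hd q hq]
      simp only [A₁, map_smul, Prod.smul_snd]
      rw [hA2 q hq, map_smul, smul_eq_mul, smul_smul]
      have h6 : θ (B.1 (e q).2) = 1 := by
        have := congrArg θ (hA2 q hq)
        rw [map_smul, smul_eq_mul] at this
        exact mul_left_cancel₀ (hθ q hq) (by rw [← this, mul_one])
      rw [h6, mul_one, inv_mul_cancel₀ (hθ q hq), one_smul])
  rw [hν, hd x hx, map_smul, Prod.smul_snd, hA2 x hx, smul_smul] at key
  rw [hzx]
  exact ⟨_, key.symm⟩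

end IsNormalForm

end Reduction

/-! ### Linear coordinates adapted to the generators and the operator -/

section Linear

variable {E : Type*} [NormedAddCommGroup E] [NormedSpace ℝ E] [FiniteDimensional ℝ E]

/-- Linear coordinates `(s, (t, v))` in which the `Z_i` are the unit vectors of the `s`-directions,
such that `s` and `t` factor through `P` and `t` does not vanish on `A`. -/
theorem exists_adapted_coordinates {m : ℕ} {Z : Fin m → E} {A : E} {P : E →ₗ[ℝ] E}
    (hPP : ∀ x, P (P x) = P x)
    (hind : LinearIndependent ℝ fun o : Option (Fin m) => P (o.elim A Z)) :
    ∃ (n : ℕ) (Λ : E ≃L[ℝ] (Fin m → ℝ) × (Option (Fin n) → ℝ)),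
      (∀ i, Λ (Z i) = (Pi.single i 1, 0)) ∧ (Λ A).2 none = 1 ∧ (∀ x, (Λ (P x)).1 = (Λ x).1) ∧
      ∀ x, (Λ (P x)).2 none = (Λ x).2 none := by
  classical
  let c : (Option (Fin m) → ℝ) →ₗ[ℝ] E := Fintype.linearCombination ℝ fun o => o.elim A Z
  have hinj : LinearMap.ker (P.comp c) = ⊥ := by
    have : P.comp c = Fintype.linearCombination ℝ fun o : Option (Fin m) => P (o.elim A Z) := by
      ext o
      simp [c, Fintype.linearCombination_apply]
    rw [this, LinearMap.ker_eq_bot]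
    exact hind.fintypeLinearCombination_injective
  -- The map `f = g ∘ P` factors through `P` and reads off the coefficients on `Z` and `A`. It
  -- supplies `s` and `t`, while coordinates on its kernel supply the remaining `v`.
  obtain ⟨g, hg⟩ := LinearMap.exists_leftInverse_of_injective (P.comp c) hinj
  let f : E →ₗ[ℝ] (Option (Fin m) → ℝ) := g.comp P
  have hfc : ∀ a, f (c a) = a := fun a => DFunLike.congr_fun hg a
  have hfP : ∀ x, f (P x) = f x := fun x => by
    show g (P (P x)) = g (P x)
    rw [hPP]
  have hcs : ∀ o : Option (Fin m), c (Pi.single o 1) = o.elim A Z := fun o => by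
    simp [c, Fintype.linearCombination_apply, Pi.single_apply]
  have hfsurj : LinearMap.range f = ⊤ := LinearMap.range_eq_top.2 fun a => ⟨c a, hfc a⟩
  have hdim := f.finrank_range_add_finrank_ker
  rw [hfsurj, finrank_top, Module.finrank_fintype_fun_eq_card, Fintype.card_option,
    Fintype.card_fin] at hdim
  let κ := (Module.finBasis ℝ (LinearMap.ker f)).equivFun
  let n := Module.finrank ℝ (LinearMap.ker f)
  let d : E →ₗ[ℝ] LinearMap.ker f := (LinearMap.id - c.comp f).codRestrict _ fun x => by
    simp [hfc]
  let Λ₀ : E →ₗ[ℝ] (Fin m → ℝ) × (Option (Fin n) → ℝ) :=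
    (LinearMap.pi fun i => (LinearMap.proj (some i)).comp f).prod
      (LinearMap.pi fun o => o.elim ((LinearMap.proj none).comp f) fun j =>
        (LinearMap.proj j).comp (κ.toLinearMap.comp d))
  have h1 : ∀ x i, (Λ₀ x).1 i = f x (some i) := fun x i => rfl
  have h2 : ∀ x, (Λ₀ x).2 none = f x none := fun x => rfl
  have h3 : ∀ x j, (Λ₀ x).2 (some j) = κ (d x) j := fun x j => rfl
  have hΛinj : Function.Injective Λ₀ := by
    rw [← LinearMap.ker_eq_bot, LinearMap.ker_eq_bot']
    intro x hx
    have hf : f x = 0 := by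
      ext o
      cases o with
      | none => rw [← h2, hx]; rfl
      | some i => rw [← h1, hx]; rfl
    have hκ : κ (d x) = 0 := by
      ext j
      rw [← h3, hx]
      rfl
    have hd : d x = 0 := κ.map_eq_zero_iff.1 hκ
    have : x - c (f x) = 0 := congrArg Subtype.val hd
    rwa [hf, map_zero, sub_zero] at this
  have hfin : Module.finrank ℝ E = Module.finrank ℝ ((Fin m → ℝ) × (Option (Fin n) → ℝ)) := by
    rw [Module.finrank_prod, Module.finrank_fintype_fun_eq_card, Module.finrank_fintype_fun_eq_card,
      Fintype.card_option, Fintype.card_fin, Fintype.card_fin]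
    omega
  let Λ := (LinearEquiv.ofInjectiveOfFinrankEq Λ₀ hΛinj hfin).toContinuousLinearEquiv
  have hΛ : ∀ x, Λ x = Λ₀ x := fun x => rfl
  have hdc : ∀ a, d (c a) = 0 := fun a => Subtype.ext (by simp [d, hfc])
  refine ⟨n, Λ, fun i => ?_, ?_, fun x => ?_, fun x => ?_⟩
  · have hZ : Z i = c (Pi.single (some i) 1) := (hcs (some i)).symm
    rw [hΛ, hZ]
    refine Prod.ext ?_ ?_
    · ext j
      rw [h1, hfc]
      simp [Pi.single_apply]
    · ext o
      cases o with
      | none => rw [h2, hfc]; simp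
      | some j => rw [h3, hdc]; simp
  · have hA : A = c (Pi.single none 1) := (hcs none).symm
    rw [hΛ, h2, hA, hfc]
    simp
  · rw [hΛ, hΛ]
    ext i
    rw [h1, h1, hfP]
  · rw [hΛ, hΛ, h2, h2, hfP]

end Linear

/-! ### One application of the method to a transitive solvable algebra -/

/-- The requirements under which all the generators of a subalgebra can be used. -/
structure Stage.Admissible (S : Stage) (s : LieSubalgebra ℝ (VF S.U)) (p : Option S.ι → ℝ) :
    Prop where
  le : s ≤ S.gens
  mem : p ∈ S.U
  symmetry : ∀ X ∈ s, ∀ q ∈ S.U, ∃ μ : ℝ, lieBracket ℝ X.1 S.A.1 q = μ • S.A.1 q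
  transitive : ∀ X ∈ s, ∀ c : ℝ, X.1 p = c • S.A.1 p → X = 0
  point : ∀ X ∈ s, ∀ q ∈ S.U, ∀ q' ∈ S.U, q none = q' none →
    (∀ i ∈ S.vars, q (some i) = q' (some i)) →
    X.1 q none = X.1 q' none ∧ ∀ i ∈ S.vars, X.1 q (some i) = X.1 q' (some i)
  transitive_vars : ∀ X ∈ LieAlgebra.derivedAbelianOfIdeal (⊤ : LieIdeal ℝ s), ∀ c : ℝ,
    X.1.1 p none = c * S.A.1 p none → (∀ i ∈ S.vars, X.1.1 p (some i) = c * S.A.1 p (some i)) →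
    X = 0

open Classical in
/-- The projection of the space of the `(t, v)` to the variables. -/
noncomputable def varProj {ι : Type} [Fintype ι] (V : Set ι) :
    (Option ι → ℝ) →L[ℝ] (Option ι → ℝ) :=
  ContinuousLinearMap.pi fun o => o.elim (ContinuousLinearMap.proj none) fun i =>
    if i ∈ V then ContinuousLinearMap.proj (some i) else 0

section VarProj

variable {ι : Type} [Fintype ι] {V : Set ι}

@[simp]
theorem varProj_none (x : Option ι → ℝ) : varProj V x none = x none := rfl

theorem varProj_some_of_mem (x : Option ι → ℝ) {i : ι} (hi : i ∈ V) :
    varProj V x (some i) = x (some i) := by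
  simp [varProj, hi]

theorem varProj_some_of_not_mem (x : Option ι → ℝ) {i : ι} (hi : i ∉ V) :
    varProj V x (some i) = 0 := by
  simp [varProj, hi]

theorem varProj_eq_iff {x y : Option ι → ℝ} : varProj V x = varProj V y ↔
    x none = y none ∧ ∀ i ∈ V, x (some i) = y (some i) := by
  constructor
  · intro h
    refine ⟨congrFun h none, fun i hi => ?_⟩
    rw [← varProj_some_of_mem x hi, h, varProj_some_of_mem y hi]
  · rintro ⟨h0, h⟩
    ext o
    cases o with
    | none => exact h0
    | some i =>
      by_cases hi : i ∈ V
      · rw [varProj_some_of_mem x hi, varProj_some_of_mem y hi, h i hi]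
      · rw [varProj_some_of_not_mem x hi, varProj_some_of_not_mem y hi]

theorem varProj_varProj (x : Option ι → ℝ) : varProj V (varProj V x) = varProj V x :=
  varProj_eq_iff.2 ⟨rfl, fun _ hi => varProj_some_of_mem x hi⟩

end VarProj

theorem VF.sum_smul_apply {E : Type*} [NormedAddCommGroup E] [NormedSpace ℝ E] {U : Opens E}
    {ι : Type*} [Fintype ι] (c : ι → ℝ) (Z : ι → VF U) (p : E) :
    (∑ i, c i • Z i : VF U).1 p = ∑ i, c i • (Z i).1 p := by
  simp [Finset.sum_apply]

theorem injective_fderiv_of_mem_source {E G : Type*} [NormedAddCommGroup E] [NormedSpace ℝ E]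
    [NormedAddCommGroup G] [NormedSpace ℝ G] {e : OpenPartialHomeomorph E G}
    (he : ContDiffOn ℝ ∞ e e.source) (hes : ContDiffOn ℝ ∞ e.symm e.target) {x : E}
    (hx : x ∈ e.source) : Function.Injective (fderiv ℝ e x) := by
  have h1 := ((he.contDiffAt (e.open_source.mem_nhds hx)).differentiableAt
    (n := ∞) (by simp)).hasFDerivAt
  have h2 := ((hes.contDiffAt (e.open_target.mem_nhds (e.map_source hx))).differentiableAt
    (n := ∞) (by simp)).hasFDerivAt
  have h3 : HasFDerivAt (e.symm ∘ e) (.id ℝ E) x :=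
    (hasFDerivAt_id x).congr_of_eventuallyEq
      (Filter.eventually_of_mem (e.open_source.mem_nhds hx) fun y hy => e.left_inv hy)
  exact Function.LeftInverse.injective (g := fderiv ℝ e.symm (e x))
    fun v => DFunLike.congr_fun ((h2.comp x h1).unique h3) v

namespace Stage.Admissible

variable {S : Stage} {s : LieSubalgebra ℝ (VF S.U)} {p : Option S.ι → ℝ}

/-- Transitivity on the variables forbids a nontrivial combination of the `Z_i` from projecting to a
multiple of `A`. The projection of `A` itself is nonzero, its `t`-component being `1`. -/
theorem linearIndependent (h : S.Admissible s p) {m : ℕ} {Z : Fin m → VF S.U}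
    (hZ : LinearIndependent ℝ Z)
    (hZa : ∀ c : Fin m → ℝ, ∃ X ∈ LieAlgebra.derivedAbelianOfIdeal (⊤ : LieIdeal ℝ s),
      (X : VF S.U) = ∑ i, c i • Z i) :
    LinearIndependent ℝ fun o : Option (Fin m) =>
      varProj S.vars (o.elim (S.A.1 p) fun i => (Z i).1 p) := by
  have key : ∀ (c : Fin m → ℝ) (k : ℝ), ∑ i, c i • varProj S.vars ((Z i).1 p)
      = k • varProj S.vars (S.A.1 p) → c = 0 := by
    intro c k hck
    obtain ⟨X, hX, hXc⟩ := hZa c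
    have hX' : varProj S.vars (X.1.1 p) = varProj S.vars (k • S.A.1 p) := by
      rw [hXc, VF.sum_smul_apply, map_sum, map_smul, ← hck]
      simp
    obtain ⟨h0, h1⟩ := varProj_eq_iff.1 hX'
    have hX0 := h.transitive_vars X hX k h0 h1
    rw [hX0] at hXc
    have := Fintype.linearIndependent_iff.1 hZ c hXc.symm
    exact funext this
  rw [linearIndependent_option]
  refine ⟨Fintype.linearIndependent_iff.2 fun c hc => congrFun (key c 0 ?_), fun hmem => ?_⟩
  · rw [zero_smul, ← hc]
    rfl
  · obtain ⟨c, hc⟩ := (Submodule.mem_span_range_iff_exists_fun ℝ).1 hmem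
    have hc0 := key c 1 (by rw [one_smul]; exact hc)
    rw [hc0] at hc
    have h1 := congrFun hc none
    simp [S.A_time p h.mem] at h1

/-- The last nonzero derived algebra of a transitive solvable algebra of generators can be
transformed to normal form. -/
theorem exists_step (h : S.Admissible s p) [FiniteDimensional ℝ s] [LieAlgebra.IsSolvable s]
    (hs : s ≠ ⊥) : ∃ (S' : Stage) (m : ℕ) (σ : Step S S' m) (p' : Option S'.ι → ℝ), σ.kept = s ∧
      S'.Admissible S'.gens p' ∧ FiniteDimensional ℝ S'.gens ∧ LieAlgebra.IsSolvable S'.gens ∧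
      Module.finrank ℝ S'.gens + m = Module.finrank ℝ s := by
  -- The last nonzero derived algebra: being Abelian, its basis commutes; being an ideal, it grants
  -- the inheritance conditions to all of `s`.
  set a := LieAlgebra.derivedAbelianOfIdeal (⊤ : LieIdeal ℝ s) with ha
  have hafd : FiniteDimensional ℝ a := inferInstanceAs (FiniteDimensional ℝ a.toSubmodule)
  have ha0 : a ≠ ⊥ := by
    rw [ha, Ne, LieAlgebra.abelian_of_solvable_ideal_eq_bot_iff]
    intro htop
    refine hs (eq_bot_iff.2 fun X hX => ?_)
    have : (⟨X, hX⟩ : s) ∈ (⊤ : LieIdeal ℝ s) := LieSubmodule.mem_top _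
    rw [htop, LieSubmodule.mem_bot] at this
    exact (LieSubalgebra.mem_bot _).2 (congrArg Subtype.val this)
  have haab : IsLieAbelian a := LieAlgebra.abelian_derivedAbelianOfIdeal _
  let m := Module.finrank ℝ a
  let b : Module.Basis (Fin m) ℝ a := Module.finBasis ℝ a
  let j : a →ₗ[ℝ] VF S.U := s.toSubmodule.subtype.comp a.toSubmodule.subtype
  have hj : Function.Injective j := Subtype.val_injective.comp Subtype.val_injective
  let Z : Fin m → VF S.U := fun i => j (b i)
  have hZs : ∀ i, Z i ∈ s := fun i => (b i).1.2
  have hspan : Submodule.span ℝ (range Z) = LinearMap.range j := by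
    rw [show range Z = j '' range b by rw [← range_comp]; rfl, Submodule.span_image, b.span_eq,
      Submodule.map_top]
  have hspan' : ∀ X : s, X.1 ∈ Submodule.span ℝ (range Z) ↔ X ∈ a := by
    intro X
    rw [hspan]
    constructor
    · rintro ⟨Y, hY⟩
      have : Y.1 = X := Subtype.ext hY
      exact this ▸ Y.2
    · exact fun hX => ⟨⟨X, hX⟩, rfl⟩
  have hZind : LinearIndependent ℝ Z := b.linearIndependent.map' j (LinearMap.ker_eq_bot.2 hj)
  have habel : ∀ i k, ⁅Z i, Z k⁆ = 0 := by
    intro i k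
    have : ⁅b i, b k⁆ = 0 := haab.trivial _ _
    exact congrArg (fun X : a => (X : s).1) this
  have hinh : ∀ i, ∀ X ∈ s, ⁅Z i, X⁆ ∈ Submodule.span ℝ (range Z) := by
    intro i X hX
    refine (hspan' ⁅((b i : a) : s), (⟨X, hX⟩ : s)⁆).2 ?_
    exact lie_mem_left ℝ s a _ _ (b i).2
  have hlin := h.linearIndependent hZind fun c =>
    ⟨((∑ i, c i • b i : a) : s), (∑ i, c i • b i : a).2, by
      show j (∑ i, c i • b i) = _
      rw [map_sum]
      exact Finset.sum_congr rfl fun i _ => map_smul j _ _⟩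
  obtain ⟨n, Λ, hΛZ, hΛA, hΛP, hΛt⟩ := exists_adapted_coordinates
    (P := (varProj S.vars : (Option S.ι → ℝ) →ₗ[ℝ] Option S.ι → ℝ)) varProj_varProj hlin
  let θ : (Option (Fin n) → ℝ) →L[ℝ] ℝ := ContinuousLinearMap.proj none
  obtain ⟨e, r, hr, hpe, -, heU, het, hes, hess, heZ, hepoint, heA⟩ :=
    exists_straightening (Z := fun i => (Z i).1) S.U.isOpen h.mem (fun i => (Z i).2.1)
      (fun i k x hx => by
        have := congrFun (congrArg Subtype.val (habel k i)) x
        rw [VF.lie_val, lieBracket_eq] at this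
        exact sub_eq_zero.1 this)
      (P := varProj S.vars) varProj_varProj
      (fun i x hx y hy hxy => by
        obtain ⟨h0, h1⟩ := varProj_eq_iff.1 hxy
        exact varProj_eq_iff.2 (h.point (Z i) (hZs i) x hx y hy h0 h1))
      Λ hΛZ hΛP θ hΛt S.A.2.1.continuousOn (by
        show (Λ (S.A.1 p)).2 none ≠ 0
        rw [hΛA]
        exact one_ne_zero)
  have hnf : IsNormalForm e r fun i => (Z i).1 :=
    ⟨het, hes, hess, heZ, fun x hx i => differentiableAt_of_mem (Z i) (heU hx)⟩
  let V : Opens (Option (Fin n) → ℝ) := ⟨Metric.ball 0 r, Metric.isOpen_ball⟩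
  have hV : (V : Set (Option (Fin n) → ℝ)) = Metric.ball 0 r := rfl
  have hVt : (V : Set (Option (Fin n) → ℝ)) = Prod.snd '' e.target := hnf.snd_image.symm
  have hZ0 : ∀ X ∈ Submodule.span ℝ (range Z), IsReducedForm e X (0 : VF V) := by
    intro X hX
    induction hX using Submodule.span_induction with
    | mem X hX =>
      obtain ⟨i, rfl⟩ := hX
      intro x hx
      rw [heZ x hx i]
      rfl
    | zero => exact fun x _ => by simp
    | add X Y _ _ h₁ h₂ => simpa using h₁.add h₂
    | smul c X _ h => simpa using h.smul c
  have hredex : ∀ X ∈ s, ∃ Y : VF V, IsReducedForm e X Y := fun X hX =>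
    hnf.exists_isReducedForm heU hV X fun x hx i => hZ0 _ (hinh i X hX) x hx
  obtain ⟨φ, hφ⟩ := exists_reductionHom heU hVt hes s hredex
  have hφ0 : ∀ X : s, X.1 ∈ Submodule.span ℝ (range Z) → φ X = 0 := fun X hX =>
    (hφ X).unique hVt (hZ0 _ hX)
  obtain ⟨B, u, hBt, hBu⟩ := hnf.exists_operator heU hV S.A
    (fun x hx i => h.symmetry (Z i) (hZs i) x (heU hx)) heA
  -- If `X` and `c A` agree at `p` up to the `s`-directions, then `X - ∑ k_i Z_i` equals `c A` at
  -- `p` and vanishes by transitivity. This gives the independence of the reduced forms, the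
  -- transitivity of the reduced algebra and the kernel of `φ`.
  have htrans : ∀ X ∈ s, ∀ c : ℝ, (fderiv ℝ e p (X.1 p)).2 = c • (fderiv ℝ e p (S.A.1 p)).2 →
      X ∈ Submodule.span ℝ (range Z) := by
    intro X hX c hXc
    set k := (fderiv ℝ e p (X.1 p - c • S.A.1 p)).1 with hk
    have h1 : X.1 p - c • S.A.1 p = ∑ i, k i • (Z i).1 p := by
      refine injective_fderiv_of_mem_source hes hess hpe ?_
      refine Prod.ext ?_ ?_
      · rw [← hk, map_sum, Prod.fst_sum]
        ext l
        simp [heZ p hpe, Pi.single_apply]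
      · rw [map_sub, map_smul, Prod.snd_sub, Prod.smul_snd, hXc, sub_self, map_sum, Prod.snd_sum]
        simp [heZ p hpe]
    have h2 : (∑ i, k i • Z i) ∈ s.toSubmodule :=
      Submodule.sum_mem _ fun i _ => Submodule.smul_mem _ _ (hZs i)
    have h3 := h.transitive (X - ∑ i, k i • Z i) (sub_mem hX h2) c (by
      rw [Submodule.coe_sub, Pi.sub_apply, VF.sum_smul_apply, ← h1]
      abel)
    rw [sub_eq_zero.1 h3]
    exact Submodule.sum_mem _ fun i _ => Submodule.smul_mem _ _ (Submodule.subset_span ⟨i, rfl⟩)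
  let S' : Stage :=
    { ι := Fin n
      vars := univ
      U := V
      A := B
      A_time := hBt
      gens := φ.range }
  let σ : Step S S' m :=
    { pos := by
        have : Nontrivial a := (LieSubmodule.nontrivial_iff_ne_bot ℝ s s).2 ha0
        exact Module.finrank_pos
      Z := Z
      kept := s
      kept_le := h.le
      Z_mem := hZs
      Z_indep := hZind
      abelian := habel
      inherit := hinh
      chart := e
      source_nonempty := ⟨p, hpe⟩
      source_subset := heU
      smooth := hes
      smooth_symm := hess
      point := fun x hx y hy h0 h1 => hepoint x hx y hy (varProj_eq_iff.2 ⟨h0, h1⟩)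
      normal_form := heZ
      reduced_domain := hVt
      reduced_vars := rfl
      time := heA
      u := u
      operator := hBu
      reduce := fun X hX => ⟨φ ⟨X, hX⟩, ⟨⟨X, hX⟩, rfl⟩, hφ ⟨X, hX⟩⟩
      reduced_gens := by
        rintro _ ⟨X, rfl⟩
        exact ⟨X.1, X.2, hφ X⟩
      reduced_indep := fun X hX h0 => htrans X hX 0 (by rw [h0 p hpe, zero_smul]) }
  have hp' : (e p).2 ∈ V := snd_mem_of_mem_source hVt hpe
  have htrans' : ∀ Y ∈ S'.gens, ∀ c : ℝ, Y.1 (e p).2 = c • B.1 (e p).2 → Y = 0 := by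
    rintro _ ⟨X, rfl⟩ c hc
    -- The factor `A(t)⁻¹` converts a multiple of `B` into one of the reduced part of `A`.
    refine hφ0 X (htrans X.1 X.2 (c * (θ (fderiv ℝ e p (S.A.1 p)).2)⁻¹) ?_)
    have h1 : (fderiv ℝ e p (S.A.1 p)).2
        = θ (fderiv ℝ e p (S.A.1 p)).2 • B.1 (e p).2 := congrArg Prod.snd (hBu p hpe)
    rw [mul_smul, (inv_smul_eq_iff₀ (heA p hpe)).2 h1, hφ X p hpe]
    exact hc
  refine ⟨S', m, σ, (e p).2, rfl, ?_, ?_, ?_, ?_⟩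
  · exact
      { le := le_rfl
        mem := hp'
        symmetry := by
          rintro _ ⟨X, rfl⟩ y hy
          exact hnf.exists_lieBracket_eq heU hV heA hBu (hφ X)
            (fun x hx => h.symmetry X.1 X.2 x (heU hx)) hy
        transitive := htrans'
        point := fun X _ q _ q' _ h0 h1 => by
          have : q = q' := by
            ext o
            cases o with
            | none => exact h0
            | some i => exact h1 i (mem_univ i)
          rw [this]
          exact ⟨rfl, fun _ _ => rfl⟩
        -- All coordinates of the reduced stage are variables, so the two transitivity conditions
        -- merge.
        transitive_vars := fun X _ c h0 h1 => Subtype.ext <| htrans' X.1 X.2 c <| by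
          ext o
          cases o with
          | none => exact h0
          | some i => exact h1 i (mem_univ i) }
  · exact LinearMap.finiteDimensional_range φ.toLinearMap
  · exact φ.isSolvable_range
  · have hker : LinearMap.ker φ.toLinearMap = a.toSubmodule := by
      ext X
      constructor
      · intro hX
        refine (hspan' X).1 (htrans X.1 X.2 0 ?_)
        have : φ X = 0 := hX
        rw [hφ X p hpe, this, zero_smul]
        rfl
      · exact fun hX => hφ0 X ((hspan' X).2 hX)
    have := φ.toLinearMap.finrank_range_add_finrank_ker
    rw [hker] at this
    exact this

/-- All the generators of a transitive solvable algebra can be used. -/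
theorem exists_uses (N : ℕ) : ∀ {S : Stage} {s : LieSubalgebra ℝ (VF S.U)} {p : Option S.ι → ℝ},
    S.Admissible s p → FiniteDimensional ℝ s → LieAlgebra.IsSolvable s →
    Module.finrank ℝ s ≤ N →
    ∃ L, Uses S L ∧ spanOf L = s.toSubmodule ∧ L.length = Module.finrank ℝ s := by
  have base : ∀ {S : Stage} {s : LieSubalgebra ℝ (VF S.U)}, s = ⊥ →
      ∃ L, Uses S L ∧ spanOf L = s.toSubmodule ∧ L.length = Module.finrank ℝ s := by
    rintro S _ rfl
    exact ⟨[], .nil S, by simp [spanOf], (finrank_bot ℝ (VF S.U)).symm⟩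
  induction N with
  | zero =>
    intro S s p h _ _ hN
    by_cases hs : s = ⊥
    · exact base hs
    · obtain ⟨S', m, σ, -, -, -, -, -, hdim⟩ := h.exists_step hs
      have := σ.pos
      omega
  | succ N ih =>
    intro S s p h _ _ hN
    by_cases hs : s = ⊥
    · exact base hs
    · obtain ⟨S', m, σ, p', rfl, hS', hfd, hsolv, hdim⟩ := h.exists_step hs
      have hm := σ.pos
      obtain ⟨L', hL', hspan', hlen'⟩ := ih hS' hfd hsolv (by omega)
      have hmem : ∀ Y ∈ L', Y ∈ S'.gens := fun Y hY => by
        rw [← LieSubalgebra.mem_toSubmodule, ← hspan']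
        exact Submodule.subset_span hY
      obtain ⟨L, hL, hred⟩ : ∃ L : List (VF S.U), (∀ X ∈ L, X ∈ σ.kept) ∧
          List.Forall₂ σ.Reduces L L' := by
        clear * - hmem
        induction L' with
        | nil => exact ⟨[], by simp, .nil⟩
        | cons Y L' ih =>
          obtain ⟨L, hL, hred⟩ := ih fun Y hY => hmem Y (List.mem_cons_of_mem _ hY)
          obtain ⟨X, hX, hXY⟩ := σ.reduced_gens Y (hmem Y List.mem_cons_self)
          refine ⟨X :: L, fun W hW => ?_, .cons hXY hred⟩
          rcases List.mem_cons.1 hW with rfl | hW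
          · exact hX
          · exact hL W hW
      have huses := Uses.step σ L L' hL' hL hred
      -- The list is independent because its length is the dimension of its span; a span inside
      -- `σ.kept` of full dimension is all of it.
      obtain ⟨t, -, -, htspan, htlen⟩ := huses.exists_solvable
      have hlen : (List.ofFn σ.Z ++ L).length = Module.finrank ℝ σ.kept := by
        rw [List.length_append, List.length_ofFn, hred.length_eq]
        omega
      refine ⟨_, huses, ?_, hlen⟩
      have hfdk : FiniteDimensional ℝ σ.kept.toSubmodule :=
        inferInstanceAs (FiniteDimensional ℝ σ.kept)
      refine Submodule.eq_of_le_of_finrank_eq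
        (Submodule.span_le.2 fun X hX => ?_) ?_
      · rcases List.mem_append.1 hX with hX | hX
        · obtain ⟨i, rfl⟩ := List.mem_ofFn.1 hX
          exact σ.Z_mem i
        · exact hL X hX
      · rw [htspan]
        exact htlen.symm.trans hlen

end Stage.Admissible

/-- The components of a prolongation along `x` and `y_j` are values of `ζ` at the base point, so
they depend on the variables only. -/
theorem ODESystem.admissible {k : ℕ} (S : ODESystem k) {g s : LieSubalgebra ℝ (VF S.domain)}
    (hg : ∀ X ∈ g, S.IsPointSymmetry X) (hs : s ≤ g) {p : S.Jet} (hp : p ∈ S.domain)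
    (h : S.ActsTransitively s p) : (S.stage g).Admissible s p where
  le := hs
  mem := hp
  symmetry X hX q hq := by
    obtain ⟨ζ, -, -, hζ⟩ := hg X (hs hX)
    exact ⟨_, hζ q hq⟩
  transitive := h.on_jets
  point X hX q hq q' hq' h0 h1 := by
    obtain ⟨ζ, -, hζ, -⟩ := hg X (hs hX)
    have hbase : S.base q = S.base q' := by
      funext o
      cases o with
      | none => exact h0
      | some j => exact h1 ⟨j, ⟨0, S.order_pos j⟩⟩ rfl
    rw [hζ q hq, hζ q' hq']
    refine ⟨congrFun (congrArg ζ hbase) none, ?_⟩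
    rintro ⟨j, l, hl⟩ hi
    obtain rfl : l = 0 := hi
    exact congrFun (congrArg ζ hbase) (some j)
  transitive_vars X hX c h0 h1 := by
    refine h.on_variables X hX c ?_
    funext o
    cases o with
    | none => exact h0
    | some j => exact h1 ⟨j, ⟨0, S.order_pos j⟩⟩ rfl

end FirstIntegration

/-! ### Assembly of the bounds and of the existence statement. -/

theorem theorem6 {k : ℕ} (S : FirstIntegration.ODESystem k)
    (g : LieSubalgebra ℝ (FirstIntegration.VF S.domain)) [FiniteDimensional ℝ g]
    (hg : ∀ X ∈ g, S.IsPointSymmetry X)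
    (s : LieSubalgebra ℝ (FirstIntegration.VF S.domain))
    (hs : FirstIntegration.IsMaximalSolvable g s) :
    -- No way of applying the method uses more generators than the dimension of `s`.
    (∀ L, FirstIntegration.Uses (S.stage g) L → L.length ≤ Module.finrank ℝ s) ∧
    -- All the generators of `s` can be used, if `s` acts transitively.
    (∀ p ∈ S.domain, S.ActsTransitively s p →
      ∃ L, FirstIntegration.Uses (S.stage g) L ∧ FirstIntegration.spanOf L = s.toSubmodule ∧
        L.length = Module.finrank ℝ s) ∧
    -- The generators used always form a basis of a solvable subalgebra.
    (∀ L, FirstIntegration.Uses (S.stage g) L →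
      ∃ t : LieSubalgebra ℝ (FirstIntegration.VF S.domain), t ≤ g ∧ LieAlgebra.IsSolvable t ∧
        FirstIntegration.spanOf L = t.toSubmodule ∧ L.length = Module.finrank ℝ t) ∧
    -- No generator outside `s` can be used alongside all those of `s`, in whatever order.
    (∀ L, FirstIntegration.Uses (S.stage g) L → s.toSubmodule ≤ FirstIntegration.spanOf L →
      ∀ X ∈ L, X ∈ s) ∧
    -- No generator outside `s` satisfies the inheritance conditions at each step of the
    -- integration with `s`.
    (∀ X ∈ g, (∀ n : ℕ, ∀ Z ∈ LieAlgebra.derivedSeries ℝ s n,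
        ∃ W ∈ LieAlgebra.derivedSeries ℝ s n, ⁅(Z : FirstIntegration.VF S.domain), X⁆ = W) →
      X ∈ s) ∧
    -- No Abelian set of generators outside `s` has `s` among the generators that satisfy the
    -- inheritance conditions for it.
    (∀ a : Submodule ℝ (FirstIntegration.VF S.domain), a ≤ g.toSubmodule →
      (∀ Z ∈ a, ∀ W ∈ a, ⁅Z, W⁆ = 0) → (∀ Z ∈ a, ∀ X ∈ s, ⁅Z, X⁆ ∈ a) →
      a ≤ s.toSubmodule) := by

  have hsolv := hs.solvable
  have key : ∀ L, FirstIntegration.Uses (S.stage g) L →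
      ∃ t : LieSubalgebra ℝ (FirstIntegration.VF S.domain), t ≤ g ∧ LieAlgebra.IsSolvable t ∧
        FirstIntegration.spanOf L = t.toSubmodule ∧ L.length = Module.finrank ℝ t :=
    fun L hL => hL.exists_solvable
  refine ⟨fun L hL => ?_, fun p hp htr => ?_, key, fun L hL hsL X hX => ?_, fun X hX h => ?_,
    fun a hag ha has => hs.le_of_abelian hag ha has⟩
  · obtain ⟨t, ht, htsolv, -, hlen⟩ := key L hL
    exact hlen.trans_le (hs.finrank_le t ht htsolv)
  · have hfd : FiniteDimensional ℝ s.toSubmodule :=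
      Submodule.finiteDimensional_of_le (S₂ := g.toSubmodule) hs.le
    exact FirstIntegration.Stage.Admissible.exists_uses _ (S.admissible hg hs.le hp htr) hfd hsolv
      le_rfl
  · obtain ⟨t, ht, htsolv, hspan, -⟩ := key L hL
    have hXt : X ∈ FirstIntegration.spanOf L := Submodule.subset_span hX
    rw [hspan] at hsL hXt
    exact hs.eq_of_le ht htsolv hsL ▸ hXt
  · refine hs.mem_of_lie_mem hX fun Y hY => ?_
    -- The condition at `n = 0` already says that `X` normalizes `s`.
    obtain ⟨W, -, hW⟩ := h 0 ⟨Y, hY⟩ (LieSubmodule.mem_top _)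
    rw [hW]
    exact W.2
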